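/- Consider systems $S$ of $m$ linear equations $e_1,\dots,e_m$ in $n$ variables $z_1,\dots,z_n$ over $\mathrm{GF}(2)$, where $e_j$ has the form $\sum_{i\in I_j} z_i=b_j$ with $\emptyset\ne I_j\subseteq\{1,\dots,n\}$ and has a positive integral weight $w_j$ (written in binary); let $W=w_1+\cdots+w_m$. Given $S$ and a positive integer $k$ (the parameter), the problem LinALB asks whether some assignment of values to the variables satisfies equations of total weight at least $W/2+k$. Call $S$ reduced if $I_j\ne I_q$ for all $j\neq q$ (so no two equations with the same left-hand side are left to be merged). **Theorem.** The following special cases of LinALB for reduced systems $S$ are fixed-parameter tractable, that is, decidable in time $f(k)\,|S|^{c}$ with $f$ computable and $c$ constant: 1. there is a set $U$ of variables such that each equation of $S$ contains an odd number of variables from $U$; 2. each equation of $S$ contains at most $r$ variables, where $r$ is a constant; 3. each variable appears in at most $\rho$ equations of $S$, where $\rho$ is a constant. Moreover, each of these problems has a kernel with $O(k^2)$ equations and $O(k^2)$ variables (the constant depends only on $r$ in case 2 and only on $\rho$ in case 3): there is a polynomial-time algorithm that maps $(S,k)$ to a decision-equivalent instance $(S',k')$ of the same special case, where $k'\le k$,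 the system $S'$ has $O(k^2)$ equations and $O(k^2)$ variables, and the size of $S'$ (weights included) is bounded by a computable function of $k$. -/

import Mathlib

/-! ### Model of computation: WHILE programs on binary trees

Data are finite binary trees (cons cells). A program transforms one tree; several variables are
kept in one tree by pairing. Every elementary step is charged the full size of the tree it works
on, so that a step is never cheaper (up to a polynomial) than its execution on a Turing machine;
conversely one Turing machine step is a bounded number of elementary steps on the tree that holds
the configuration. Polynomial time and fixed-parameter tractable time are therefore the usual
ones. -/

namespace MaxLin

/-- Binary trees, the data of programs. -/
inductive Data : Type
  | nil : Data
  | cons : Data → Data → Data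

/-- The size of a tree: its number of nodes, leaves included. -/
def Data.size : Data → ℕ
  | .nil => 1
  | .cons a b => a.size + b.size + 1

/-- Programs. -/
inductive Prog : Type
  /-- return the input -/
  | id : Prog
  /-- return `nil` -/
  | nil : Prog
  /-- the left subtree (`nil` on `nil`) -/
  | hd : Prog
  /-- the right subtree (`nil` on `nil`) -/
  | tl : Prog
  /-- run both programs on the input, and combine the results by `cons` -/
  | pair : Prog → Prog → Prog
  /-- `seq p q`: run `p`, then run `q` on the result -/
  | seq : Prog → Prog → Prog
  /-- `ite c p q`: if `c` returns a tree other than `nil`, run `p`, else run `q` -/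
  | ite : Prog → Prog → Prog → Prog
  /-- `loop c p`: while `c` returns a tree other than `nil` on the current tree, replace the
  current tree by the result of `p` -/
  | loop : Prog → Prog → Prog

/-- `Eval p x y t`: on input `x` the program `p` halts with output `y` after time `t`. -/
inductive Eval : Prog → Data → Data → ℕ → Prop
  | id (x : Data) : Eval .id x x x.size
  | nil (x : Data) : Eval .nil x .nil x.size
  | hd_nil : Eval .hd .nil .nil Data.nil.size
  | hd_cons (a b : Data) : Eval .hd (.cons a b) a (Data.cons a b).size
  | tl_nil : Eval .tl .nil .nil Data.nil.size
  | tl_cons (a b : Data) : Eval .tl (.cons a b) b (Data.cons a b).size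
  | pair {p q : Prog} {x a b : Data} {s t : ℕ} :
      Eval p x a s → Eval q x b t → Eval (.pair p q) x (.cons a b) (s + t + x.size)
  | seq {p q : Prog} {x y z : Data} {s t : ℕ} :
      Eval p x y s → Eval q y z t → Eval (.seq p q) x z (s + t + x.size)
  | ite_true {c p q : Prog} {x v y : Data} {s t : ℕ} :
      Eval c x v s → v ≠ .nil → Eval p x y t → Eval (.ite c p q) x y (s + t + x.size)
  | ite_false {c p q : Prog} {x y : Data} {s t : ℕ} :
      Eval c x .nil s → Eval q x y t → Eval (.ite c p q) x y (s + t + x.size)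
  | loop_stop {c p : Prog} {x : Data} {s : ℕ} :
      Eval c x .nil s → Eval (.loop c p) x x (s + x.size)
  | loop_step {c p : Prog} {x v y z : Data} {s t u : ℕ} :
      Eval c x v s → v ≠ .nil → Eval p x y t → Eval (.loop c p) y z u →
      Eval (.loop c p) x z (s + t + u + x.size)

/-- Programs are deterministic: output and running time are determined by the input. -/
theorem Eval.deterministic {p : Prog} {x y y' : Data} {t t' : ℕ}
    (h : Eval p x y t) (h' : Eval p x y' t') : y = y' ∧ t = t' := by
  induction h generalizing y' t' with
  | id | nil | hd_nil | hd_cons | tl_nil | tl_cons => cases h'; exact ⟨rfl, rfl⟩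
  | pair _ _ ih1 ih2 =>
    cases h' with
    | pair g1 g2 =>
      obtain ⟨rfl, rfl⟩ := ih1 g1
      obtain ⟨rfl, rfl⟩ := ih2 g2
      exact ⟨rfl, rfl⟩
  | seq _ _ ih1 ih2 =>
    cases h' with
    | seq g1 g2 =>
      obtain ⟨rfl, rfl⟩ := ih1 g1
      obtain ⟨rfl, rfl⟩ := ih2 g2
      exact ⟨rfl, rfl⟩
  | ite_true _ hv _ ih1 ih2 =>
    cases h' with
    | ite_true g1 gv g2 =>
      obtain ⟨_, rfl⟩ := ih1 g1
      obtain ⟨rfl, rfl⟩ := ih2 g2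
      exact ⟨rfl, rfl⟩
    | ite_false g1 g2 => exact absurd (ih1 g1).1 hv
  | ite_false _ _ ih1 ih2 =>
    cases h' with
    | ite_true g1 gv g2 => exact absurd (ih1 g1).1.symm gv
    | ite_false g1 g2 =>
      obtain ⟨_, rfl⟩ := ih1 g1
      obtain ⟨rfl, rfl⟩ := ih2 g2
      exact ⟨rfl, rfl⟩
  | loop_stop _ ih1 =>
    cases h' with
    | loop_stop g1 =>
      obtain ⟨_, rfl⟩ := ih1 g1
      exact ⟨rfl, rfl⟩
    | loop_step g1 gv g2 g3 => exact absurd (ih1 g1).1.symm gv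
  | loop_step _ hv _ _ ih1 ih2 ih3 =>
    cases h' with
    | loop_stop g1 => exact absurd (ih1 g1).1 hv
    | loop_step g1 gv g2 g3 =>
      obtain ⟨_, rfl⟩ := ih1 g1
      obtain ⟨rfl, rfl⟩ := ih2 g2
      obtain ⟨rfl, rfl⟩ := ih3 g3
      exact ⟨rfl, rfl⟩

/-! ### Encodings -/

/-- A bit as a tree. -/
def encodeBool : Bool → Data
  | false => .nil
  | true => .cons .nil .nil

/-- A list of trees as a tree. -/
def encodeList : List Data → Data
  | [] => .nil
  | a :: l => .cons a (encodeList l)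

/-- A natural number in binary, least significant bit first. -/
def encodeNat (n : ℕ) : Data := encodeList (n.bits.map encodeBool)

/-! ### Fixed-parameter tractability and kernels -/

/-- A parameterized problem over main parts in `α`, with a positive integer as parameter:
which pairs `(I, k)` are instances of the problem, and to which of them the answer is yes. -/
structure ParamProblem (α : Type) where
  IsInstance : α → ℕ+ → Prop
  IsYes : α → ℕ+ → Prop
  isInstance_of_isYes : ∀ I k, IsYes I k → IsInstance I k

/-- The input given to a program for the pair `(I, k)`; the parameter is written in binary. -/
def encodePair {α : Type} (enc : α → Data) (I : α) (k : ℕ+) : Data :=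
  .cons (enc I) (encodeNat k)

/-- The problem is fixed-parameter tractable: one program decides for all `(I, k)` whether
`(I, k)` is a yes-instance (it returns a tree other than `nil` to accept), in time
`f(k) |I| ^ c` for a computable function `f` and a constant `c`. -/
def IsFPT {α : Type} (enc : α → Data) (Q : ParamProblem α) : Prop :=
  ∃ (p : Prog) (f : ℕ → ℕ) (c : ℕ), Computable f ∧
    ∀ (I : α) (k : ℕ+), ∃ (y : Data) (t : ℕ), Eval p (encodePair enc I k) y t ∧
      t ≤ f k * (enc I).size ^ c ∧ (y ≠ .nil ↔ Q.IsYes I k)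

/-- `K` is a kernelization: it is computed in time polynomial in the size of `(I, k)`, it always
returns an instance `(I', k')` of the same problem, which is decision-equivalent to `(I, k)`, with
`k' ≤ k` and with the size of `I'` bounded by a computable function of `k`.
(A pair that is not an instance is thus sent to a no-instance.) -/
def IsKernelization {α : Type} (enc : α → Data) (Q : ParamProblem α)
    (K : α → ℕ+ → α × ℕ+) : Prop :=
  (∃ (p : Prog) (C c : ℕ), ∀ (I : α) (k : ℕ+), ∃ t : ℕ,
    Eval p (encodePair enc I k) (encodePair enc (K I k).1 (K I k).2) t ∧
      t ≤ C * (encodePair enc I k).size ^ c) ∧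
  (∀ I k, Q.IsInstance (K I k).1 (K I k).2) ∧
  (∀ I k, Q.IsYes I k ↔ Q.IsYes (K I k).1 (K I k).2) ∧
  (∀ I k, (K I k).2 ≤ k) ∧
  (∃ g : ℕ → ℕ, Computable g ∧ ∀ I k, (enc (K I k).1).size ≤ g k)

/-! ### Weighted linear systems over GF(2) -/

/-- An equation `∑ i ∈ supp, z i = rhs` over GF(2) in `n` variables, with a nonempty set of
variables and a positive integral weight. -/
structure LinEq (n : ℕ) where
  supp : Finset (Fin n)
  supp_nonempty : supp.Nonempty
  rhs : ZMod 2
  weight : ℕ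
  weight_pos : 0 < weight

/-- A system of `m` weighted equations in `n` variables over GF(2). -/
structure LinSystem where
  n : ℕ
  m : ℕ
  eqn : Fin m → LinEq n

/-- Encoding of an equation: its row of `n` coefficients, its right-hand side, its weight in
binary. -/
def LinEq.encode {n : ℕ} (e : LinEq n) : Data :=
  .cons (encodeList (List.ofFn fun i : Fin n => encodeBool (decide (i ∈ e.supp))))
    (.cons (encodeBool (decide (e.rhs = 1))) (encodeNat e.weight))

/-- Encoding of a system: the number of variables in unary, and the list of the equations. -/
def LinSystem.encode (S : LinSystem) : Data :=
  .cons (encodeList (List.replicate S.n .nil))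
    (encodeList (List.ofFn fun j : Fin S.m => (S.eqn j).encode))

namespace LinSystem

variable (S : LinSystem)

/-- The total weight `W` of the equations. -/
def totalWeight : ℕ := ∑ j, (S.eqn j).weight

/-- The total weight of the equations satisfied by the assignment `z`. -/
def satWeight (z : Fin S.n → ZMod 2) : ℕ :=
  ∑ j with (∑ i ∈ (S.eqn j).supp, z i) = (S.eqn j).rhs, (S.eqn j).weight

/-- Some assignment satisfies equations of total weight at least `W/2 + k`. -/
def AboveBound (k : ℕ+) : Prop :=
  ∃ z : Fin S.n → ZMod 2, (S.totalWeight : ℚ) / 2 + ((k : ℕ) : ℚ) ≤ (S.satWeight z : ℚ)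

/-- The rule that merges two equations with the same left-hand side is not applicable. -/
def IsReduced : Prop :=
  ∀ j q : Fin S.m, j ≠ q → (S.eqn j).supp ≠ (S.eqn q).supp

/-- Some set `U` of variables meets every equation in an odd number of variables. -/
def HasOddSet : Prop :=
  ∃ U : Finset (Fin S.n), ∀ j, Odd ((S.eqn j).supp ∩ U).card

/-- The maximum number `r(S)` of variables in an equation. -/
def maxArity : ℕ := Finset.univ.sup fun j => (S.eqn j).supp.card

/-- The number of equations in which the variable `i` appears. -/
def occurrences (i : Fin S.n) : ℕ :=
  (Finset.univ.filter fun j => i ∈ (S.eqn j).supp).card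

end LinSystem

/-- Max Lin-2 parameterized above the tight lower bound `W/2`, restricted to the systems that are
reduced and satisfy `P`. -/
def linALB (P : LinSystem → Prop) : ParamProblem LinSystem where
  IsInstance S _ := S.IsReduced ∧ P S
  IsYes S k := (S.IsReduced ∧ P S) ∧ S.AboveBound k
  isInstance_of_isYes _ _ h := h.1

/-- The restricted problem has a kernel with `O(k ^ 2)` equations and variables. -/
def HasQuadraticKernel (P : LinSystem → Prop) : Prop :=
  ∃ K : LinSystem → ℕ+ → LinSystem × ℕ+,
    IsKernelization LinSystem.encode (linALB P) K ∧
    ∃ C : ℕ, ∀ S k, (K S k).1.m ≤ C * (k : ℕ) ^ 2 ∧ (K S k).1.n ≤ C * (k : ℕ) ^ 2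

end MaxLin

/-!
Let `X z` be the weight of the equations that `z` satisfies minus the weight of the others, so
that the question is whether `X` reaches `2 * k`. Up to signs of the coefficients, `X` is a
combination of the characters that belong to the sets of variables of the equations. These are
nontrivial, and distinct in a reduced system, so for uniformly random `z` the mean of `X` is zero
and its variance is the sum of the squared weights. In each special case, `X` is somewhere as large
as a constant fraction of its standard deviation. With an odd set of variables, flipping these
variables turns `X` into `-X`. In the other cases the fourth moment is at most a constant times the
squared variance: by Bonami's inequality (`sum_polyChi_pow_four_le`) if equations are short, and by
counting the coincidences among symmetric differences (`sum_pow_four_le_of_occurrences_le`) if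
variables occur rarely; `sum_sq_le_of_le` then bounds the maximum from below. Hence a reduced
no-instance has a sum of squared weights of at most `D * k ^ 2`, so it has `O(k ^ 2)` equations
and weights of `O(k)`.

The kernelization rejects pairs that are not instances, accepts if there are many equations or if
some weight is large, and otherwise keeps the pivot columns of the coefficient matrix only. These
span the column space (`exists_dot_sel_pivotMask`), so the attainable vectors of left-hand sides
stay the same; hence the answer, reducedness and the existence of an odd set are preserved, and
there are at most as many variables as equations. Exhaustive search in the kernel shows
fixed-parameter tractability.

Running times are handled by `InTime B f`: some program computes the function `f` between encoded
types within a bound from the class `B`. The closure properties of `InTime` hold for every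
`TimeClass`, and are used for polynomial bounds (kernelization) and for primitive recursive bounds
(exhaustive search), where folds need no control of the intermediate results.
-/

/-! ### Typed programs and classes of time bounds -/

namespace MaxLin

/-- Types whose elements are handed to programs as trees. -/
class Enc (α : Type) where
  /-- The tree that represents an element. -/
  enc : α → Data

open Enc (enc)

instance : Enc Data := ⟨fun d => d⟩
instance : Enc Unit := ⟨fun _ => .nil⟩
instance : Enc Bool := ⟨encodeBool⟩
instance : Enc ℕ := ⟨encodeNat⟩
instance {α β : Type} [Enc α] [Enc β] : Enc (α × β) := ⟨fun x => .cons (enc x.1) (enc x.2)⟩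
instance {α : Type} [Enc α] : Enc (List α) := ⟨fun l => encodeList (l.map enc)⟩

variable {α β γ δ σ : Type} [Enc α] [Enc β] [Enc γ] [Enc δ] [Enc σ]

/-- The size of the tree that represents `a`. -/
def sz (a : α) : ℕ := (enc a).size

theorem Data.size_pos (d : Data) : 0 < d.size := by
  cases d <;> simp [Data.size]

theorem sz_pos (a : α) : 0 < sz a := Data.size_pos _

theorem sz_prod (a : α) (b : β) : sz (a, b) = sz a + sz b + 1 := rfl

theorem sz_list_nil : sz ([] : List α) = 1 := rfl

theorem sz_list_cons (a : α) (l : List α) : sz (a :: l) = sz a + sz l + 1 := rfl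

theorem sz_unit (u : Unit) : sz u = 1 := rfl

theorem sz_bool_le (b : Bool) : sz b ≤ 3 := by cases b <;> decide

theorem sz_append (l₁ l₂ : List α) : sz (l₁ ++ l₂) + 1 = sz l₁ + sz l₂ := by
  induction l₁ with
  | nil => simp only [List.nil_append, sz_list_nil]; omega
  | cons a l ih => simp only [List.cons_append, sz_list_cons]; omega

theorem sz_mem_le {a : α} {l : List α} (h : a ∈ l) : sz a ≤ sz l := by
  induction l with
  | nil => simp at h
  | cons b l ih =>
    rw [sz_list_cons]
    rcases List.mem_cons.1 h with rfl | h
    · omega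
    · have := ih h
      omega

theorem length_lt_sz (l : List α) : l.length < sz l := by
  induction l with
  | nil => exact Nat.one_pos
  | cons a l ih => rw [sz_list_cons, List.length_cons]; omega

theorem sz_list_le {l : List α} {c : ℕ} (h : ∀ a ∈ l, sz a ≤ c) :
    sz l ≤ l.length * (c + 1) + 1 := by
  induction l with
  | nil => simp [sz_list_nil]
  | cons a l ih =>
    have h1 := h a (by simp)
    have h2 := ih fun b hb => h b (by simp [hb])
    rw [sz_list_cons, List.length_cons, add_mul]
    omega

/-- A program writes its output, so the output is no larger than the running time. -/
theorem Eval.size_le {p : Prog} {x y : Data} {t : ℕ} (h : Eval p x y t) : y.size ≤ t := by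
  induction h with
  | nil x => exact x.size_pos
  | @pair _ _ x => have := x.size_pos; simp only [Data.size]; omega
  | _ => (try simp only [Data.size]); omega

/-- Classes of monotone time bounds with the closure properties that programs need. -/
class TimeClass (B : (ℕ → ℕ) → Prop) : Prop where
  mono {f : ℕ → ℕ} : B f → Monotone f
  id : B fun n => n
  const (c : ℕ) : B fun _ => c
  add {f g : ℕ → ℕ} : B f → B g → B fun n => f n + g n
  mul {f g : ℕ → ℕ} : B f → B g → B fun n => f n * g n
  comp {f g : ℕ → ℕ} : B f → B g → B fun n => f (g n)

/-- Some program computes `f` within a time bound from the class `B`. -/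
def InTime (B : (ℕ → ℕ) → Prop) (f : α → β) : Prop :=
  ∃ (p : Prog) (b : ℕ → ℕ), B b ∧ ∀ a, ∃ t, Eval p (enc a) (enc (f a)) t ∧ t ≤ b (sz a)

namespace InTime

variable {B : (ℕ → ℕ) → Prop}

/-- Only the encoded values of a function matter. -/
theorem congr_enc {f : α → β} {g : γ → δ} (hf : InTime B f) (φ : γ → α)
    (h : ∀ c, enc (φ c) = enc c) (h' : ∀ c, enc (f (φ c)) = enc (g c)) : InTime B g := by
  obtain ⟨p, b, hb, hp⟩ := hf
  refine ⟨p, b, hb, fun c => ?_⟩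
  have := hp (φ c)
  rwa [h, h', sz, h] at this

theorem of_eq {f g : α → β} (hf : InTime B f) (h : ∀ a, f a = g a) : InTime B g :=
  (funext h : f = g) ▸ hf

theorem sz_le {f : α → β} (hf : InTime B f) : ∃ b, B b ∧ ∀ a, sz (f a) ≤ b (sz a) := by
  obtain ⟨p, b, hb, hp⟩ := hf
  refine ⟨b, hb, fun a => ?_⟩
  obtain ⟨t, h1, h2⟩ := hp a
  exact h1.size_le.trans h2

variable [TimeClass B]

open TimeClass

protected theorem id : InTime B fun a : α => a :=
  ⟨.id, fun n => n, TimeClass.id, fun _ => ⟨_, .id _, le_rfl⟩⟩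

theorem comp {f : β → γ} {g : α → β} (hf : InTime B f) (hg : InTime B g) :
    InTime B fun a => f (g a) := by
  obtain ⟨p, b, hb, hp⟩ := hf
  obtain ⟨q, d, hd, hq⟩ := hg
  refine ⟨.seq q p, fun n => d n + b (d n) + n, add (add hd (TimeClass.comp hb hd)) TimeClass.id,
    fun a => ?_⟩
  obtain ⟨t, h1, h2⟩ := hq a
  obtain ⟨s, h3, h4⟩ := hp (g a)
  refine ⟨_, .seq h1 h3, ?_⟩
  have := mono hb (h1.size_le.trans h2)
  simp only [sz] at *
  omega

theorem pair {f : α → β} {g : α → γ} (hf : InTime B f) (hg : InTime B g) :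
    InTime B fun a => (f a, g a) := by
  obtain ⟨p, b, hb, hp⟩ := hf
  obtain ⟨q, d, hd, hq⟩ := hg
  refine ⟨.pair p q, fun n => b n + d n + n, add (add hb hd) TimeClass.id, fun a => ?_⟩
  obtain ⟨t, h1, h2⟩ := hp a
  obtain ⟨s, h3, h4⟩ := hq a
  refine ⟨_, .pair h1 h3, ?_⟩
  simp only [sz] at *
  omega

theorem fst_id : InTime B fun x : α × β => x.1 :=
  ⟨.hd, fun n => n, TimeClass.id, fun _ => ⟨_, .hd_cons _ _, le_rfl⟩⟩

theorem snd_id : InTime B fun x : α × β => x.2 :=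
  ⟨.tl, fun n => n, TimeClass.id, fun _ => ⟨_, .tl_cons _ _, le_rfl⟩⟩

theorem fst {f : γ → α × β} (hf : InTime B f) : InTime B fun c => (f c).1 := fst_id.comp hf

theorem snd {f : γ → α × β} (hf : InTime B f) : InTime B fun c => (f c).2 := snd_id.comp hf

theorem const (b : β) : InTime B fun _ : α => b := by
  suffices h : ∀ d : Data, InTime B fun _ : α => d from
    (h (enc b)).congr_enc (fun a => a) (fun _ => rfl) fun _ => rfl
  intro d
  induction d with
  | nil => exact ⟨.nil, fun n => n, TimeClass.id, fun a => ⟨_, .nil _, le_rfl⟩⟩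
  | cons d e hd he => exact (hd.pair he).congr_enc (fun a => a) (fun _ => rfl) fun _ => rfl

theorem cond {c : α → Bool} {f g : α → β} (hc : InTime B c) (hf : InTime B f)
    (hg : InTime B g) : InTime B fun a => cond (c a) (f a) (g a) := by
  obtain ⟨p, b, hb, hp⟩ := hc
  obtain ⟨q, d, hd, hq⟩ := hf
  obtain ⟨r, e, he, hr⟩ := hg
  refine ⟨.ite p q r, fun n => b n + (d n + e n) + n, add (add hb (add hd he)) TimeClass.id,
    fun a => ?_⟩
  obtain ⟨t, h1, h2⟩ := hp a
  obtain ⟨s, h3, h4⟩ := hq a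
  obtain ⟨u, h5, h6⟩ := hr a
  simp only [sz] at *
  cases hca : c a
  · rw [hca] at h1
    exact ⟨_, .ite_false h1 h5, by omega⟩
  · rw [hca] at h1
    exact ⟨_, .ite_true h1 (by simp [enc, encodeBool]) h3, by omega⟩

theorem not {f : α → Bool} (hf : InTime B f) : InTime B fun a => !f a :=
  (hf.cond (const false) (const true)).of_eq fun a => by cases f a <;> rfl

theorem and {f g : α → Bool} (hf : InTime B f) (hg : InTime B g) : InTime B fun a => f a && g a :=
  (hf.cond hg (const false)).of_eq fun a => by cases f a <;> rfl

theorem or {f g : α → Bool} (hf : InTime B f) (hg : InTime B g) : InTime B fun a => f a || g a :=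
  (hf.cond (const true) hg).of_eq fun a => by cases f a <;> rfl

theorem xor {f g : α → Bool} (hf : InTime B f) (hg : InTime B g) :
    InTime B fun a => Bool.xor (f a) (g a) :=
  (hf.cond hg.not hg).of_eq fun a => by cases f a <;> simp

theorem cons {f : γ → α} {l : γ → List α} (hf : InTime B f) (hl : InTime B l) :
    InTime B fun c => f c :: l c :=
  (hf.pair hl).congr_enc (fun a => a) (fun _ => rfl) fun _ => rfl

theorem tail {l : γ → List α} (hl : InTime B l) : InTime B fun c => (l c).tail := by
  refine comp (f := fun l : List α => l.tail) ?_ hl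
  refine ⟨.tl, fun n => n, TimeClass.id, fun a => ?_⟩
  cases a with
  | nil => exact ⟨_, .tl_nil, le_rfl⟩
  | cons a l => exact ⟨_, .tl_cons _ _, le_rfl⟩

theorem headD {l : γ → List α} (hl : InTime B l) {d : α} (hd : enc d = .nil) :
    InTime B fun c => (l c).headD d := by
  refine comp (f := fun l : List α => l.headD d) ?_ hl
  refine ⟨.hd, fun n => n, TimeClass.id, fun a => ?_⟩
  cases a with
  | nil => exact ⟨_, hd ▸ Eval.hd_nil, le_rfl⟩
  | cons a l => exact ⟨_, .hd_cons _ _, le_rfl⟩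

theorem isEmpty {l : γ → List α} (hl : InTime B l) : InTime B fun c => (l c).isEmpty := by
  obtain ⟨p, b, hb, hp⟩ := const (α := List α) (B := B) false
  obtain ⟨q, d, hd, hq⟩ := const (α := List α) (B := B) true
  refine comp (f := fun l : List α => l.isEmpty) ?_ hl
  refine ⟨.ite .id p q, fun n => n + (b n + d n) + n,
    add (add TimeClass.id (add hb hd)) TimeClass.id, fun a => ?_⟩
  obtain ⟨t, h1, h2⟩ := hp a
  obtain ⟨s, h3, h4⟩ := hq a
  simp only [sz] at *
  cases a with
  | nil => exact ⟨_, .ite_false (.id _) h3, by simp only [enc, List.map_nil, encodeList] at *; omega⟩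
  | cons a l => exact ⟨_, .ite_true (.id _) nofun h1, by omega⟩

/-- Folding over a list: the loop runs through the triples of context, state and remaining
list. It stays within the class if the intermediate states do. -/
theorem foldl {l : γ → List α} {i : γ → σ} {s : γ → σ → α → σ} (hl : InTime B l)
    (hi : InTime B i) (hs : InTime B fun x : γ × σ × α => s x.1 x.2.1 x.2.2)
    {b : ℕ → ℕ} (hb : B b)
    (hsz : ∀ c l₁ l₂, l c = l₁ ++ l₂ → sz (l₁.foldl (s c) (i c)) ≤ b (sz c)) :
    InTime B fun c => (l c).foldl (s c) (i c) := by
  obtain ⟨bl, hbl, hl'⟩ := hl.sz_le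
  have hbody : InTime B fun x : γ × σ × (α × List α) =>
      (x.1, s x.1 x.2.1 x.2.2.1, x.2.2.2) :=
    fst_id.pair ((hs.comp (fst_id.pair (snd_id.fst.pair snd_id.snd.fst))).pair snd_id.snd.snd)
  have hcond : InTime B fun x : γ × σ × List α => x.2.2 := snd_id.snd
  obtain ⟨p, bp, hbp, hp⟩ := hbody
  obtain ⟨q, bq, hbq, hq⟩ := hcond
  have hstart : InTime B fun c => (c, i c, l c) := InTime.id.pair (hi.pair hl)
  have hfinal : InTime B fun x : γ × σ × List α => x.2.1 := snd_id.fst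
  let M : ℕ → ℕ := fun n => n + b n + bl n + 2
  have hM : B M := add (add (add TimeClass.id hb) hbl) (TimeClass.const _)
  suffices hloop : ∃ (r : Prog) (br : ℕ → ℕ), B br ∧ ∀ c, ∃ t,
      Eval r (enc (c, i c, l c)) (enc (c, (l c).foldl (s c) (i c), ([] : List α))) t ∧
        t ≤ br (sz c) by
    obtain ⟨r, br, hbr, hr⟩ := hloop
    obtain ⟨p₁, b₁, hb₁, h₁⟩ := hstart
    obtain ⟨p₂, b₂, hb₂, h₂⟩ := hfinal
    refine ⟨.seq (.seq p₁ r) p₂, fun n => b₁ n + br n + n + b₂ (br n) + n,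
      add (add (add (add hb₁ hbr) TimeClass.id) (TimeClass.comp hb₂ hbr)) TimeClass.id,
      fun c => ?_⟩
    obtain ⟨t₁, e₁, g₁⟩ := h₁ c
    obtain ⟨t₂, e₂, g₂⟩ := hr c
    obtain ⟨t₃, e₃, g₃⟩ := h₂ (c, (l c).foldl (s c) (i c), [])
    refine ⟨_, .seq (.seq e₁ e₂) e₃, ?_⟩
    have := mono hb₂ (e₂.size_le.trans g₂)
    simp only [sz] at *
    omega
  refine ⟨.loop q p, fun n => (bl n + 1) * (bq (M n) + bp (M n) + M n),
    mul (add hbl (TimeClass.const _))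
      (add (add (TimeClass.comp hbq hM) (TimeClass.comp hbp hM)) hM), fun c => ?_⟩
  have key : ∀ rest l₁, l c = l₁ ++ rest → ∃ t,
      Eval (.loop q p) (enc (c, l₁.foldl (s c) (i c), rest))
        (enc (c, (l c).foldl (s c) (i c), ([] : List α))) t ∧
      t ≤ (rest.length + 1) * (bq (M (sz c)) + bp (M (sz c)) + M (sz c)) := by
    intro rest
    induction rest with
    | nil =>
      intro l₁ h
      have e : l c = l₁ := by simpa using h
      obtain ⟨t, e₁, g₁⟩ := hq (c, l₁.foldl (s c) (i c), [])
      rw [e]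
      refine ⟨_, Eval.loop_stop e₁, ?_⟩
      have h1 := hsz c l₁ [] h
      have h2 : sz (c, l₁.foldl (s c) (i c), ([] : List α)) ≤ M (sz c) := by
        simp only [sz_prod, sz_list_nil, M]
        have := hl' c
        have := sz_pos (l c)
        omega
      have h3 := mono hbq h2
      simp only [sz, List.length_nil, Nat.zero_add, Nat.one_mul] at *
      omega
    | cons a rest ih =>
      intro l₁ h
      obtain ⟨u, e₃, g₃⟩ := ih (l₁ ++ [a]) (by simpa using h)
      obtain ⟨t, e₁, g₁⟩ := hq (c, l₁.foldl (s c) (i c), a :: rest)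
      obtain ⟨v, e₂, g₂⟩ := hp (c, l₁.foldl (s c) (i c), a, rest)
      have h1 := hsz c l₁ _ h
      have h2 : sz (c, l₁.foldl (s c) (i c), a :: rest) ≤ M (sz c) := by
        simp only [sz_prod, M]
        have h3 := hl' c
        have h4 := sz_append l₁ (a :: rest)
        rw [← h] at h4
        have := sz_pos l₁
        omega
      rw [List.foldl_append] at e₃
      refine ⟨_, .loop_step e₁ nofun e₂ e₃, ?_⟩
      have h3 := mono hbq h2
      have h4 : v ≤ bp (M (sz c)) := g₂.trans (mono hbp h2)
      rw [List.length_cons, add_mul _ 1]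
      simp only [sz] at *
      omega
  obtain ⟨t, e, g⟩ := key (l c) [] rfl
  refine ⟨t, e, g.trans (Nat.mul_le_mul_right _ ?_)⟩
  have := length_lt_sz (l c)
  have := hl' c
  omega

/-- A fold stays within the class if each step adds to a measure of the state an amount that
depends on the context only. -/
theorem foldl_of_measure {l : γ → List α} {i : γ → σ} {s : γ → σ → α → σ} (hl : InTime B l)
    (hi : InTime B i) (hs : InTime B fun x : γ × σ × α => s x.1 x.2.1 x.2.2)
    {q b₀ : ℕ → ℕ} (hq : B q) (hb₀ : B b₀) (μ : σ → ℕ) (hμ : ∀ x, sz x ≤ μ x)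
    (hμi : ∀ c, μ (i c) ≤ b₀ (sz c))
    (hstep : ∀ c x a, a ∈ l c → μ (s c x a) ≤ μ x + q (sz c)) :
    InTime B fun c => (l c).foldl (s c) (i c) := by
  obtain ⟨bl, hbl, hl'⟩ := hl.sz_le
  refine foldl hl hi hs (b := fun n => b₀ n + bl n * q n) (add hb₀ (mul hbl hq)) ?_
  intro c l₁ l₂ h
  have key : ∀ (l₁ : List α) (x : σ), (∀ a ∈ l₁, a ∈ l c) →
      μ (l₁.foldl (s c) x) ≤ μ x + l₁.length * q (sz c) := by
    intro l₁
    induction l₁ with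
    | nil => intro x _; simp
    | cons a l₁ ih =>
      intro x hx
      have h1 := ih (s c x a) fun d hd => hx d (by simp [hd])
      have h2 := hstep c x a (hx a (by simp))
      rw [List.foldl_cons, List.length_cons, add_mul]
      omega
  have h1 := key l₁ (i c) fun a ha => by simp [h, ha]
  have h2 : l₁.length ≤ bl (sz c) := by
    have h3 := length_lt_sz (l c)
    have h4 := hl' c
    rw [h, List.length_append] at h3
    rw [h] at h4
    omega
  exact (hμ _).trans (h1.trans (add_le_add (hμi c) (Nat.mul_le_mul_right _ h2)))

theorem reverse {l : γ → List α} (hl : InTime B l) : InTime B fun c => (l c).reverse := by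
  obtain ⟨bl, hbl, hl'⟩ := hl.sz_le
  refine (foldl_of_measure (i := fun _ => []) (s := fun _ x a => a :: x) hl (const _)
    (snd_id.snd.cons snd_id.fst) (q := fun n => bl n + 1) (b₀ := fun _ => 1)
    (add hbl (TimeClass.const _)) (TimeClass.const _) sz (fun _ => le_rfl) (fun _ => le_rfl)
    ?_).of_eq fun c => by simp
  intro c x a ha
  have := sz_mem_le ha
  have := hl' c
  rw [sz_list_cons]
  omega

theorem append {l₁ l₂ : γ → List α} (h₁ : InTime B l₁) (h₂ : InTime B l₂) :
    InTime B fun c => l₁ c ++ l₂ c := by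
  obtain ⟨b₁, hb₁, h₁'⟩ := h₁.sz_le
  obtain ⟨b₂, hb₂, h₂'⟩ := h₂.sz_le
  refine (foldl_of_measure (s := fun _ x a => a :: x) h₁.reverse h₂
    (snd_id.snd.cons snd_id.fst) (q := fun n => b₁ n + 1) (b₀ := b₂)
    (add hb₁ (TimeClass.const _)) hb₂ sz (fun _ => le_rfl) h₂' ?_).of_eq fun c => by simp
  intro c x a ha
  have := sz_mem_le (List.mem_reverse.1 ha)
  have := h₁' c
  rw [sz_list_cons]
  omega

theorem map {l : γ → List α} {f : γ → α → β} (hl : InTime B l)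
    (hf : InTime B fun x : γ × α => f x.1 x.2) : InTime B fun c => (l c).map (f c) := by
  obtain ⟨bl, hbl, hl'⟩ := hl.sz_le
  obtain ⟨bf, hbf, hf'⟩ := hf.sz_le
  refine (foldl_of_measure (i := fun _ => []) (s := fun c x a => f c a :: x) hl.reverse (const _)
    ((hf.comp (fst_id.pair snd_id.snd)).cons snd_id.fst)
    (q := fun n => bf (n + bl n + 1) + 1) (b₀ := fun _ => 1)
    (add (TimeClass.comp hbf (add (add TimeClass.id hbl) (TimeClass.const _)))
      (TimeClass.const _)) (TimeClass.const _) sz (fun _ => le_rfl) (fun _ => le_rfl)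
    ?_).of_eq fun c => ?_
  · intro c x a ha
    have h1 := sz_mem_le (List.mem_reverse.1 ha)
    have h2 := hl' c
    have h3 := hf' (c, a)
    have h4 : sz (c, a) ≤ sz c + bl (sz c) + 1 := by rw [sz_prod]; omega
    have := mono hbf h4
    rw [sz_list_cons]
    dsimp only at h3
    omega
  · induction l c with
    | nil => rfl
    | cons a t ih =>
      simp only [List.reverse_cons, List.foldl_append, ih, List.map_cons, List.foldl_cons,
        List.foldl_nil]

theorem filter {l : γ → List α} {f : γ → α → Bool} (hl : InTime B l)
    (hf : InTime B fun x : γ × α => f x.1 x.2) : InTime B fun c => (l c).filter (f c) := by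
  obtain ⟨bl, hbl, hl'⟩ := hl.sz_le
  refine (foldl_of_measure (i := fun _ => []) (s := fun c x a => bif f c a then a :: x else x)
    hl.reverse (const _)
    ((hf.comp (fst_id.pair snd_id.snd)).cond (snd_id.snd.cons snd_id.fst) snd_id.fst)
    (q := fun n => bl n + 1) (b₀ := fun _ => 1)
    (add hbl (TimeClass.const _)) (TimeClass.const _) sz (fun _ => le_rfl) (fun _ => le_rfl)
    ?_).of_eq fun c => ?_
  · intro c x a ha
    have h1 := sz_mem_le (List.mem_reverse.1 ha)
    have h2 := hl' c
    cases f c a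
    · simp
    · rw [cond_true, sz_list_cons]
      omega
  · induction l c with
    | nil => rfl
    | cons a t ih => cases h : f c a <;> simp [List.foldl_append, ← ih, h]

theorem all {l : γ → List α} {f : γ → α → Bool} (hl : InTime B l)
    (hf : InTime B fun x : γ × α => f x.1 x.2) : InTime B fun c => (l c).all (f c) :=
  (hl.filter (f := fun c a => !f c a) hf.not).isEmpty.of_eq fun c => by
    rw [Bool.eq_iff_iff]
    simp [List.filter_eq_nil_iff]

theorem any {l : γ → List α} {f : γ → α → Bool} (hl : InTime B l)
    (hf : InTime B fun x : γ × α => f x.1 x.2) : InTime B fun c => (l c).any (f c) :=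
  (hl.filter (f := f) hf).isEmpty.not.of_eq fun c => by
    rw [Bool.eq_iff_iff]
    simp [List.filter_eq_nil_iff]

theorem zip {l : γ → List α} {r : γ → List Bool} (hl : InTime B l) (hr : InTime B r) :
    InTime B fun c => (l c).zip (r c) := by
  obtain ⟨bl, hbl, hl'⟩ := hl.sz_le
  obtain ⟨br, hbr, hr'⟩ := hr.sz_le
  have hs : InTime B fun x : γ × (List Bool × List (α × Bool)) × α =>
      bif x.2.1.1.isEmpty then x.2.1
        else (x.2.1.1.tail, (x.2.2, x.2.1.1.headD false) :: x.2.1.2) :=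
    snd_id.fst.fst.isEmpty.cond snd_id.fst (snd_id.fst.fst.tail.pair
      ((snd_id.snd.pair (snd_id.fst.fst.headD rfl)).cons snd_id.fst.snd))
  refine (foldl_of_measure (i := fun c => (r c, ([] : List (α × Bool))))
    (s := fun _ (x : List Bool × List (α × Bool)) a =>
      bif x.1.isEmpty then x else (x.1.tail, (a, x.1.headD false) :: x.2))
    hl (hr.pair (const _)) hs
    (q := fun n => bl n + 5) (b₀ := fun n => br n + 2)
    (add hbl (TimeClass.const _)) (add hbr (TimeClass.const _)) sz (fun _ => le_rfl)
    (fun c => ?_) ?_).snd.reverse.of_eq fun c => ?_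
  · rw [sz_prod, sz_list_nil]
    have := hr' c
    omega
  · rintro c ⟨t, x⟩ a ha
    have h1 := sz_mem_le ha
    have h2 := hl' c
    cases t with
    | nil => simp
    | cons d t =>
      have := sz_bool_le d
      simp only [sz_prod, sz_list_cons, List.isEmpty_cons, cond_false, List.tail_cons,
        List.headD_cons]
      omega
  · have key : ∀ (l : List α) (r : List Bool) (x : List (α × Bool)),
        (l.foldl (fun (x : List Bool × List (α × Bool)) a =>
          bif x.1.isEmpty then x else (x.1.tail, (a, x.1.headD false) :: x.2)) (r, x)).2
          = (l.zip r).reverse ++ x := by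
      intro l
      induction l with
      | nil => simp
      | cons a l ih =>
        rintro (_ | ⟨d, r⟩) x
        · simpa using ih [] x
        · simp [ih, -List.headD_eq_head?_getD]
    simp [key, -List.headD_eq_head?_getD]

/-- Dropping from `l` as many elements as `r` has. -/
theorem drop_length {l : γ → List α} {r : γ → List β} (hl : InTime B l) (hr : InTime B r) :
    InTime B fun c => (l c).drop (r c).length := by
  obtain ⟨bl, hbl, hl'⟩ := hl.sz_le
  have htail : ∀ x : List α, sz x.tail ≤ sz x := fun x => by
    cases x with
    | nil => exact le_rfl
    | cons a x => rw [sz_list_cons, List.tail_cons]; omega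
  refine (foldl_of_measure (s := fun _ x _ => x.tail) hr hl snd_id.fst.tail
    (q := fun _ => 0) (TimeClass.const _) hbl sz (fun _ => le_rfl) hl'
    fun c x a _ => htail x).of_eq fun c => ?_
  generalize l c = x
  induction r c generalizing x with
  | nil => simp
  | cons a r ih => simp [ih, List.drop_tail]

end InTime

/-! ### Polynomial and primitive recursive time bounds -/

/-- Monotone polynomially bounded functions. -/
def PolyB (f : ℕ → ℕ) : Prop := Monotone f ∧ ∃ C c, ∀ n, f n ≤ C * (n + 1) ^ c

/-- Monotone primitive recursive functions. -/
def PrimB (f : ℕ → ℕ) : Prop := Monotone f ∧ Primrec f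

instance : TimeClass PolyB where
  mono h := h.1
  id := ⟨monotone_id, 1, 1, fun n => by simp⟩
  const c := ⟨monotone_const, c, 0, fun n => by simp⟩
  add := by
    rintro f g ⟨hf, C, c, hC⟩ ⟨hg, D, d, hD⟩
    refine ⟨fun a b h => add_le_add (hf h) (hg h), C + D, c + d, fun n => ?_⟩
    rw [add_mul]
    refine add_le_add ((hC n).trans ?_) ((hD n).trans ?_)
    · exact Nat.mul_le_mul_left _ (Nat.pow_le_pow_right (by omega) (by omega))
    · exact Nat.mul_le_mul_left _ (Nat.pow_le_pow_right (by omega) (by omega))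
  mul := by
    rintro f g ⟨hf, C, c, hC⟩ ⟨hg, D, d, hD⟩
    refine ⟨fun a b h => Nat.mul_le_mul (hf h) (hg h), C * D, c + d, fun n => ?_⟩
    calc f n * g n ≤ C * (n + 1) ^ c * (D * (n + 1) ^ d) := Nat.mul_le_mul (hC n) (hD n)
      _ = C * D * (n + 1) ^ (c + d) := by ring
  comp := by
    rintro f g ⟨hf, C, c, hC⟩ ⟨hg, D, d, hD⟩
    refine ⟨hf.comp hg, C * (D + 1) ^ c, d * c, fun n => (hC _).trans ?_⟩
    have h1 : g n + 1 ≤ (D + 1) * (n + 1) ^ d := by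
      have := Nat.one_le_pow d (n + 1) (by omega)
      have := hD n
      rw [add_mul]
      omega
    calc C * (g n + 1) ^ c ≤ C * ((D + 1) * (n + 1) ^ d) ^ c :=
          Nat.mul_le_mul_left _ (Nat.pow_le_pow_left h1 _)
      _ = C * (D + 1) ^ c * (n + 1) ^ (d * c) := by rw [mul_pow, pow_mul]; ring

instance : TimeClass PrimB where
  mono h := h.1
  id := ⟨monotone_id, Primrec.id⟩
  const c := ⟨monotone_const, Primrec.const c⟩
  add := fun ⟨hf, hf'⟩ ⟨hg, hg'⟩ =>
    ⟨fun _ _ h => add_le_add (hf h) (hg h), Primrec.nat_add.comp hf' hg'⟩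
  mul := fun ⟨hf, hf'⟩ ⟨hg, hg'⟩ =>
    ⟨fun _ _ h => Nat.mul_le_mul (hf h) (hg h), Primrec.nat_mul.comp hf' hg'⟩
  comp := fun ⟨hf, hf'⟩ ⟨hg, hg'⟩ => ⟨hf.comp hg, hf'.comp hg'⟩

/-- Primitive recursive bounds are closed under iteration, so folds need no control of the
intermediate states. -/
theorem InTime.foldl_prim {l : γ → List α} {i : γ → σ} {s : γ → σ → α → σ} (hl : InTime PrimB l)
    (hi : InTime PrimB i) (hs : InTime PrimB fun x : γ × σ × α => s x.1 x.2.1 x.2.2) :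
    InTime PrimB fun c => (l c).foldl (s c) (i c) := by
  obtain ⟨bl, hbl, hl'⟩ := hl.sz_le
  obtain ⟨bi, hbi, hi'⟩ := hi.sz_le
  obtain ⟨bs, hbs, hs'⟩ := hs.sz_le
  let φ : ℕ → ℕ → ℕ := fun n m => m + bs (n + (m + bl n + 1) + 1)
  have hφ : ∀ {n n' m m'}, n ≤ n' → m ≤ m' → φ n m ≤ φ n' m' := fun h h' =>
    add_le_add h' (hbs.1 (by have := hbl.1 h; omega))
  have hφit : ∀ {n n' m m'} (k : ℕ), n ≤ n' → m ≤ m' → (φ n)^[k] m ≤ (φ n')^[k] m' := by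
    intro n n' m m' k h h'
    induction k with
    | zero => simpa
    | succ k ih => rw [Function.iterate_succ_apply', Function.iterate_succ_apply']; exact hφ h ih
  have hφk : ∀ n m, Monotone fun k => (φ n)^[k] m := fun n m =>
    monotone_nat_of_le_succ fun k => by
      rw [Function.iterate_succ_apply']
      exact Nat.le_add_right _ _
  refine foldl hl hi hs (b := fun n => (φ n)^[bl n] (bi n)) ⟨?_, ?_⟩ ?_
  · intro n n' h
    exact (hφit _ h (hbi.1 h)).trans (hφk _ _ (hbl.1 h))
  · refine Primrec.nat_iterate hbl.2 hbi.2 ?_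
    refine Primrec.nat_add.comp Primrec.snd (hbs.2.comp ?_)
    refine Primrec.nat_add.comp (Primrec.nat_add.comp Primrec.fst ?_) (Primrec.const 1)
    exact Primrec.nat_add.comp (Primrec.nat_add.comp Primrec.snd (hbl.2.comp Primrec.fst))
      (Primrec.const 1)
  · intro c l₁ l₂ h
    have key : ∀ (l₁ : List α) (x : σ) (m : ℕ), (∀ a ∈ l₁, a ∈ l c) → sz x ≤ m →
        sz (l₁.foldl (s c) x) ≤ (φ (sz c))^[l₁.length] m := by
      intro l₁
      induction l₁ with
      | nil => intro x m _ h; simpa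
      | cons a l₁ ih =>
        intro x m hx hm
        rw [List.foldl_cons, List.length_cons, Function.iterate_succ_apply]
        refine ih _ _ (fun d hd => hx d (by simp [hd])) ((hs' (c, x, a)).trans ?_)
        refine (hbs.1 ?_).trans (Nat.le_add_left _ _)
        have := sz_mem_le (hx a (by simp))
        have := hl' c
        simp only [sz_prod]
        omega
    refine (key l₁ _ _ (fun a ha => by simp [h, ha]) (hi' c)).trans (hφk _ _ ?_)
    have h3 := length_lt_sz (l c)
    have h4 := hl' c
    rw [h, List.length_append] at h3
    rw [h] at h4
    omega

end MaxLin

/-! ### Gaussian elimination on lists of bits -/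

namespace MaxLin

/-- The inner product of two bit vectors over GF(2). -/
def dot : List Bool → List Bool → Bool
  | a :: r, b :: z => Bool.xor (a && b) (dot r z)
  | _, _ => false

/-- The sum of two bit vectors over GF(2). -/
def xorL (r p : List Bool) : List Bool := (r.zip p).map fun x => Bool.xor x.1 x.2

/-- The entries of a row at the positions marked in a mask. -/
def sel (mask r : List Bool) : List Bool := ((r.zip mask).filter fun x => x.2).map fun x => x.1

@[simp] theorem xorL_cons (a b : Bool) (r p : List Bool) :
    xorL (a :: r) (b :: p) = Bool.xor a b :: xorL r p := rfl

@[simp] theorem xorL_nil : xorL [] [] = [] := rfl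

@[simp] theorem sel_nil (mask : List Bool) : sel mask [] = [] := rfl

@[simp] theorem sel_false_cons (a : Bool) (mask r : List Bool) :
    sel (false :: mask) (a :: r) = sel mask r := rfl

@[simp] theorem sel_true_cons (a : Bool) (mask r : List Bool) :
    sel (true :: mask) (a :: r) = a :: sel mask r := rfl

@[simp] theorem dot_nil_left (z : List Bool) : dot [] z = false := by simp [dot]

@[simp] theorem dot_nil_right (z : List Bool) : dot z [] = false := by cases z <;> simp [dot]

@[simp] theorem dot_cons (a b : Bool) (r z : List Bool) :
    dot (a :: r) (b :: z) = Bool.xor (a && b) (dot r z) := rfl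

theorem length_xorL (r p : List Bool) : (xorL r p).length = min r.length p.length := by
  simp [xorL]

theorem length_sel {mask r : List Bool} (h : r.length = mask.length) :
    (sel mask r).length = mask.count true := by
  induction mask generalizing r with
  | nil => simp_all
  | cons b mask ih =>
    obtain _ | ⟨a, r⟩ := r
    · simp at h
    · cases b <;> simp [ih (Nat.succ.inj h)]

theorem sel_xorL {mask r p : List Bool} (h : r.length = mask.length) (h' : p.length = mask.length) :
    sel mask (xorL r p) = xorL (sel mask r) (sel mask p) := by
  induction mask generalizing r p with
  | nil => simp_all
  | cons b mask ih =>
    obtain _ | ⟨a, r⟩ := r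
    · simp at h
    obtain _ | ⟨d, p⟩ := p
    · simp at h'
    cases b <;> simp [ih (Nat.succ.inj h) (Nat.succ.inj h')]

theorem dot_xorL {r p : List Bool} (h : r.length = p.length) (z : List Bool) :
    dot (xorL r p) z = Bool.xor (dot r z) (dot p z) := by
  induction r generalizing p z with
  | nil =>
    obtain rfl : p = [] := by simpa using h.symm
    simp
  | cons a r ih =>
    obtain _ | ⟨d, p⟩ := p
    · simp at h
    cases z with
    | nil => simp
    | cons b z =>
      simp only [xorL_cons, dot_cons, ih (Nat.succ.inj h)]
      cases a <;> cases b <;> cases d <;> simp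

/-- Every selection of entries extends to a full vector, by zeros at the unmarked positions. -/
theorem exists_dot_eq_dot_sel {mask y : List Bool} (h : y.length = mask.count true) :
    ∃ z : List Bool, z.length = mask.length ∧
      ∀ r : List Bool, r.length = mask.length → dot r z = dot (sel mask r) y := by
  induction mask generalizing y with
  | nil => exact ⟨[], rfl, fun r hr => by simp_all⟩
  | cons b mask ih =>
    cases b with
    | false =>
      obtain ⟨z, h1, h2⟩ := ih (y := y) (by simpa using h)
      refine ⟨false :: z, by simp [h1], fun r hr => ?_⟩
      obtain _ | ⟨a, r⟩ := r
      · simp at hr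
      · simp [h2 r (Nat.succ.inj hr)]
    | true =>
      obtain _ | ⟨d, y⟩ := y
      · simp at h
      obtain ⟨z, h1, h2⟩ := ih (y := y) (by simpa using h)
      refine ⟨d :: z, by simp [h1], fun r hr => ?_⟩
      obtain _ | ⟨a, r⟩ := r
      · simp at hr
      · simp [h2 r (Nat.succ.inj hr)]

/-- The rows with a leading one. -/
def pivotRows (M : List (List Bool)) : List (List Bool) := M.filter fun r => r.headD false

/-- One step of Gaussian elimination: clear the first column by means of the first row with a
leading one, if there is such a row, and drop both the column and that row. -/
def reduceCol (M : List (List Bool)) : List (List Bool) :=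
  bif (pivotRows M).isEmpty then M.map List.tail
  else (pivotRows M).tail.map (fun r => (xorL r ((pivotRows M).headD [])).tail) ++
    (M.filter fun r => !r.headD false).map List.tail

/-- The rows that are left when the first `n` columns have been eliminated. -/
def elimRows : ℕ → List (List Bool) → List (List Bool)
  | 0, M => M
  | n + 1, M => elimRows n (reduceCol M)

/-- The pivot columns among the first `n` columns. -/
def pivotMask : ℕ → List (List Bool) → List Bool
  | 0, _ => []
  | n + 1, M => (!(pivotRows M).isEmpty) :: pivotMask n (reduceCol M)

theorem length_pivotMask (n : ℕ) (M : List (List Bool)) : (pivotMask n M).length = n := by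
  induction n generalizing M with
  | zero => rfl
  | succ n ih => simp [pivotMask, ih]

/-- The two cases of an elimination step. -/
theorem reduceCol_cases (M : List (List Bool)) :
    ((pivotRows M).isEmpty = true ∧ (∀ r ∈ M, r.headD false = false) ∧
      reduceCol M = M.map List.tail) ∨
    ∃ (p : List Bool) (T F : List (List Bool)), (pivotRows M).isEmpty = false ∧
      (p :: (T ++ F)).Perm M ∧ p.headD false = true ∧ (∀ r ∈ T, r.headD false = true) ∧
      (∀ r ∈ F, r.headD false = false) ∧
      reduceCol M = T.map (fun r => (xorL r p).tail) ++ F.map List.tail := by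
  rcases h : pivotRows M with _ | ⟨p, T⟩
  · refine .inl ⟨rfl, fun r hr => ?_, by simp [reduceCol, h]⟩
    have := List.filter_eq_nil_iff.1 h r hr
    simpa [-List.headD_eq_head?_getD] using this
  · have hall : ∀ r ∈ p :: T, r.headD false = true := fun r hr =>
      (List.mem_filter.1 (h ▸ hr : r ∈ pivotRows M)).2
    refine .inr ⟨p, T, M.filter fun r => !r.headD false, rfl, ?_, hall p (by simp),
      fun r hr => hall r (by simp [hr]), fun r hr => ?_, by simp [reduceCol, h]⟩
    · rw [← List.cons_append, ← h]
      exact List.filter_append_perm _ M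
    · simpa [-List.headD_eq_head?_getD] using (List.mem_filter.1 hr).2

theorem length_of_mem_reduceCol {M : List (List Bool)} {n : ℕ} (h : ∀ r ∈ M, r.length = n + 1) :
    ∀ r ∈ reduceCol M, r.length = n := by
  rcases reduceCol_cases M with ⟨-, -, h'⟩ | ⟨p, T, F, -, hM, -, -, -, h'⟩
  · rw [h']
    intro r hr
    obtain ⟨s, hs, rfl⟩ := List.mem_map.1 hr
    simp [h s hs]
  · rw [h']
    intro r hr
    rcases List.mem_append.1 hr with hr | hr <;> obtain ⟨s, hs, rfl⟩ := List.mem_map.1 hr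
    · simp [length_xorL, h s (hM.subset (by simp [hs])), h p (hM.subset (by simp))]
    · simp [h s (hM.subset (by simp [hs]))]

/-- Each pivot column uses up a row. -/
theorem count_pivotMask_le (n : ℕ) (M : List (List Bool)) :
    (pivotMask n M).count true ≤ M.length := by
  induction n generalizing M with
  | zero => simp [pivotMask]
  | succ n ih =>
    have h1 := ih (reduceCol M)
    rcases reduceCol_cases M with ⟨h, -, h'⟩ | ⟨p, T, F, h, hM, -, -, -, h'⟩
    · simpa [pivotMask, h, h'] using h1
    · rw [h'] at h1
      have h2 := hM.length_eq
      simp [pivotMask, h, h'] at h1 h2 ⊢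
      omega

/-- The pivot columns span the column space. -/
theorem exists_dot_sel_pivotMask (n : ℕ) (M : List (List Bool)) (h : ∀ r ∈ M, r.length = n)
    (z : List Bool) (hz : z.length = n) :
    ∃ y : List Bool, y.length = (pivotMask n M).count true ∧
      ∀ r ∈ M, dot (sel (pivotMask n M) r) y = dot r z := by
  induction n generalizing M z with
  | zero =>
    refine ⟨[], rfl, fun r hr => ?_⟩
    obtain rfl : z = [] := by simpa using hz
    simp
  | succ n ih =>
    obtain _ | ⟨b, z⟩ := z
    · simp at hz
    obtain ⟨y, hy, hy'⟩ := ih (reduceCol M) (length_of_mem_reduceCol h) z (Nat.succ.inj hz)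
    have hlen := length_pivotMask n (reduceCol M)
    rcases reduceCol_cases M with ⟨hp, hh, h'⟩ | ⟨p, T, F, hp, hM, hp1, hT, hF, h'⟩
    · refine ⟨y, by simpa [pivotMask, hp] using hy, fun r hr => ?_⟩
      have h1 := h r hr
      have h2 := hh r hr
      have h3 := hy' r.tail (by rw [h']; exact List.mem_map_of_mem hr)
      obtain _ | ⟨a, r⟩ := r
      · simp at h1
      · obtain rfl : a = false := h2
        simpa [pivotMask, hp] using h3
    · have hp0 := h p (hM.subset (by simp))
      obtain _ | ⟨a, p⟩ := p
      · simp at hp0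
      obtain rfl : a = true := hp1
      -- the leading entry is chosen such that the pivot row keeps its value
      refine ⟨Bool.xor b (Bool.xor (dot p z) (dot (sel (pivotMask n (reduceCol M)) p) y)) :: y,
        by simpa [pivotMask, hp] using hy, fun r hr => ?_⟩
      have h1 := h r hr
      obtain _ | ⟨a, r⟩ := r
      · simp at h1
      rcases List.mem_cons.1 (hM.symm.subset hr) with hr' | hr'
      · obtain ⟨rfl, rfl⟩ := List.cons.inj hr'
        simp [pivotMask, hp]
      rcases List.mem_append.1 hr' with hr' | hr'
      · obtain rfl : a = true := hT _ hr'
        have h3 := hy' (xorL r p) (by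
          rw [h']
          exact List.mem_append_left _ (List.mem_map.2 ⟨_, hr', rfl⟩))
        have h4 := Nat.succ.inj h1
        have h5 := Nat.succ.inj hp0
        rw [sel_xorL (h4.trans hlen.symm) (h5.trans hlen.symm), dot_xorL, dot_xorL] at h3
        · simp only [pivotMask, hp, Bool.not_false, sel_true_cons, dot_cons, Bool.true_and]
          generalize dot (sel (pivotMask n (reduceCol M)) r) y = u1 at *
          generalize dot (sel (pivotMask n (reduceCol M)) p) y = u2 at *
          generalize dot r z = u3 at *
          generalize dot p z = u4 at *
          revert h3
          cases u1 <;> cases u2 <;> cases u3 <;> cases u4 <;> simp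
        · rw [h4, h5]
        · rw [length_sel (h4.trans hlen.symm), length_sel (h5.trans hlen.symm)]
      · obtain rfl : a = false := hF _ hr'
        have h3 := hy' r (by
          rw [h']
          exact List.mem_append_right _ (List.mem_map.2 ⟨_, hr', rfl⟩))
        simpa [pivotMask, hp] using h3

/-- Elimination of the first `n` variables decides whether a system is solvable when the
remaining variables have fixed values. -/
theorem exists_dot_append_eq_false_iff (n : ℕ) (M : List (List Bool)) (t : List Bool)
    (h : ∀ r ∈ M, r.length = n + t.length) :
    (∃ z : List Bool, z.length = n ∧ ∀ r ∈ M, dot r (z ++ t) = false) ↔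
      ∀ r ∈ elimRows n M, dot r t = false := by
  induction n generalizing M with
  | zero => simp [elimRows]
  | succ n ih =>
    have h0 : ∀ r ∈ M, r.length = n + t.length + 1 := fun r hr => by rw [h r hr]; omega
    rw [elimRows, ← ih _ (length_of_mem_reduceCol h0)]
    rcases reduceCol_cases M with ⟨hp, hh, h'⟩ | ⟨p, T, F, hp, hM, hp1, hT, hF, h'⟩
    · have key : ∀ (b : Bool) (z : List Bool), (∀ r ∈ M, dot r (b :: z ++ t) = false) ↔
          ∀ r ∈ reduceCol M, dot r (z ++ t) = false := by
        intro b z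
        rw [h', List.forall_mem_map]
        refine forall₂_congr fun r hr => ?_
        have h1 := h0 r hr
        have h2 := hh r hr
        obtain _ | ⟨a, r⟩ := r
        · simp at h1
        · obtain rfl : a = false := h2
          simp
      constructor
      · rintro ⟨_ | ⟨b, z⟩, hz, hz'⟩
        · simp at hz
        · exact ⟨z, Nat.succ.inj hz, (key b z).1 hz'⟩
      · rintro ⟨z, hz, hz'⟩
        exact ⟨false :: z, by simp [hz], (key false z).2 hz'⟩
    · have hp0 := h0 p (hM.subset (by simp))
      obtain _ | ⟨a, p⟩ := p
      · simp at hp0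
      obtain rfl : a = true := hp1
      have key : ∀ (b : Bool) (z : List Bool), (∀ r ∈ M, dot r (b :: z ++ t) = false) ↔
          b = dot p (z ++ t) ∧ ∀ r ∈ reduceCol M, dot r (z ++ t) = false := by
        intro b z
        have hM' : (∀ r ∈ M, dot r (b :: z ++ t) = false) ↔
            ∀ r ∈ (true :: p) :: (T ++ F), dot r (b :: z ++ t) = false :=
          forall_congr' fun r => by rw [hM.mem_iff]
        rw [hM', h', List.forall_mem_cons, List.forall_mem_append, List.forall_mem_append,
          List.forall_mem_map, List.forall_mem_map]
        have e1 : dot (true :: p) (b :: z ++ t) = false ↔ b = dot p (z ++ t) := by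
          simp only [List.cons_append, dot_cons]
          cases b <;> cases dot p (z ++ t) <;> simp
        rw [e1]
        refine and_congr_right fun hb => and_congr (forall₂_congr fun r hr => ?_)
          (forall₂_congr fun r hr => ?_)
        · have h1 := h0 r (hM.subset (by simp [hr]))
          have h2 := hT r hr
          obtain _ | ⟨a, r⟩ := r
          · simp at h1
          obtain rfl : a = true := h2
          simp only [List.cons_append, dot_cons, xorL_cons, List.tail_cons]
          rw [dot_xorL (by simp at h1 hp0; omega), hb]
          simp [Bool.xor_comm]
        · have h1 := h0 r (hM.subset (by simp [hr]))
          have h2 := hF r hr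
          obtain _ | ⟨a, r⟩ := r
          · simp at h1
          obtain rfl : a = false := h2
          simp
      constructor
      · rintro ⟨_ | ⟨b, z⟩, hz, hz'⟩
        · simp at hz
        · exact ⟨z, Nat.succ.inj hz, ((key b z).1 hz').2⟩
      · rintro ⟨z, hz, hz'⟩
        exact ⟨dot p (z ++ t) :: z, by simp [hz], (key _ z).2 ⟨rfl, hz'⟩⟩

/-! ### Running time of the elimination -/

/-- A size measure of matrices that elimination steps do not increase. -/
def rowMeasure (M : List (List Bool)) : ℕ := (M.map fun r => 4 * r.length + 2).sum + 1

theorem sz_bits_le (r : List Bool) : sz r ≤ 4 * r.length + 1 := by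
  have := sz_list_le (l := r) (c := 3) fun a _ => sz_bool_le a
  omega

theorem sz_le_rowMeasure (M : List (List Bool)) : sz M ≤ rowMeasure M := by
  induction M with
  | nil => simp [rowMeasure, sz_list_nil]
  | cons r M ih =>
    have := sz_bits_le r
    simp only [rowMeasure, List.map_cons, List.sum_cons, sz_list_cons] at *
    omega

theorem rowMeasure_le (M : List (List Bool)) : rowMeasure M ≤ 4 * sz M := by
  induction M with
  | nil => simp [rowMeasure, sz_list_nil]
  | cons r M ih =>
    have := length_lt_sz r
    simp only [rowMeasure, List.map_cons, List.sum_cons, sz_list_cons] at *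
    omega

theorem rowMeasure_map_le (M : List (List Bool)) (f : List Bool → List Bool)
    (hf : ∀ r ∈ M, (f r).length ≤ r.length) : rowMeasure (M.map f) ≤ rowMeasure M := by
  induction M with
  | nil => exact le_rfl
  | cons r M ih =>
    have h1 := hf r (by simp)
    have h2 := ih fun s hs => hf s (by simp [hs])
    simp only [rowMeasure, List.map_cons, List.sum_cons] at *
    omega

theorem rowMeasure_append (M N : List (List Bool)) :
    rowMeasure (M ++ N) + 1 = rowMeasure M + rowMeasure N := by
  simp only [rowMeasure, List.map_append, List.sum_append]
  omega

theorem rowMeasure_reduceCol_le (M : List (List Bool)) :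
    rowMeasure (reduceCol M) ≤ rowMeasure M := by
  have htail : ∀ r : List Bool, r.tail.length ≤ r.length := fun r => by simp
  rcases reduceCol_cases M with ⟨-, -, h'⟩ | ⟨p, T, F, -, hM, -, -, -, h'⟩
  · rw [h']
    exact rowMeasure_map_le _ _ fun r _ => htail r
  · have h1 := rowMeasure_map_le T (fun r => (xorL r p).tail) fun r _ =>
      (htail _).trans (by rw [length_xorL]; exact min_le_left _ _)
    have h2 := rowMeasure_map_le F List.tail fun r _ => htail r
    have h3 := rowMeasure_append (T.map fun r => (xorL r p).tail) (F.map List.tail)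
    have h4 := rowMeasure_append T F
    have h5 : rowMeasure (p :: (T ++ F)) = rowMeasure M := by
      unfold rowMeasure
      rw [(hM.map _).sum_eq]
    have h6 : rowMeasure (p :: (T ++ F)) = 4 * p.length + 2 + rowMeasure (T ++ F) := by
      simp only [rowMeasure, List.map_cons, List.sum_cons]
      omega
    rw [h']
    omega

theorem foldl_reduceCol {α : Type} (l : List α) (M : List (List Bool)) (mask : List Bool) :
    l.foldl (fun (x : List (List Bool) × List Bool) _ =>
      (reduceCol x.1, (!(pivotRows x.1).isEmpty) :: x.2)) (M, mask) =
      (elimRows l.length M, (pivotMask l.length M).reverse ++ mask) := by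
  induction l generalizing M mask with
  | nil => simp [elimRows, pivotMask]
  | cons a l ih => simp [ih, elimRows, pivotMask]

namespace InTime

variable {B : (ℕ → ℕ) → Prop} [TimeClass B] {α γ : Type} [Enc α] [Enc γ]

theorem xorL {r p : γ → List Bool} (hr : InTime B r) (hp : InTime B p) :
    InTime B fun c => xorL (r c) (p c) :=
  (hr.zip hp).map (f := fun (_ : γ) (x : Bool × Bool) => Bool.xor x.1 x.2) (xor snd_id.fst snd_id.snd)

theorem sel {m r : γ → List Bool} (hm : InTime B m) (hr : InTime B r) :
    InTime B fun c => sel (m c) (r c) :=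
  ((hr.zip hm).filter (f := fun (_ : γ) (x : Bool × Bool) => x.2) snd_id.snd).map
    (f := fun (_ : γ) (x : Bool × Bool) => x.1) snd_id.fst

theorem pivotRows {M : γ → List (List Bool)} (hM : InTime B M) :
    InTime B fun c => pivotRows (M c) :=
  hM.filter (f := fun (_ : γ) (r : List Bool) => r.headD false) (snd_id.headD rfl)

theorem reduceCol {M : γ → List (List Bool)} (hM : InTime B M) :
    InTime B fun c => reduceCol (M c) :=
  hM.pivotRows.isEmpty.cond (hM.map (f := fun _ r => r.tail) snd_id.tail)
    ((hM.pivotRows.tail.map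
        (f := fun c r => (MaxLin.xorL r ((MaxLin.pivotRows (M c)).headD [])).tail)
        (snd_id.xorL ((hM.pivotRows.headD rfl).comp fst_id)).tail).append
      ((hM.filter (f := fun _ r => !r.headD false) (snd_id.headD rfl).not).map
        (f := fun _ r => r.tail) snd_id.tail))

theorem elim {l : γ → List α} {M : γ → List (List Bool)} (hl : InTime B l) (hM : InTime B M) :
    InTime B fun c => (elimRows (l c).length (M c), pivotMask (l c).length (M c)) := by
  obtain ⟨b, hb, hb'⟩ := hM.sz_le
  have h := foldl_of_measure (i := fun c => (M c, ([] : List Bool)))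
    (s := fun _ (x : List (List Bool) × List Bool) _ =>
      (MaxLin.reduceCol x.1, (!(MaxLin.pivotRows x.1).isEmpty) :: x.2))
    hl (hM.pair (const _))
    (snd_id.fst.fst.reduceCol.pair (snd_id.fst.fst.pivotRows.isEmpty.not.cons snd_id.fst.snd))
    (q := fun _ => 4) (b₀ := fun n => 4 * b n + 2) (TimeClass.const _)
    (TimeClass.add (TimeClass.mul (TimeClass.const _) hb) (TimeClass.const _))
    (fun x => rowMeasure x.1 + sz x.2 + 1) (fun x => ?_) (fun c => ?_) fun c x a _ => ?_
  · refine (h.fst.pair h.snd.reverse).of_eq fun c => ?_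
    rw [foldl_reduceCol]
    simp
  · have := sz_le_rowMeasure x.1
    obtain ⟨x, y⟩ := x
    rw [sz_prod]
    dsimp only at *
    omega
  · have h1 := rowMeasure_le (M c)
    have h2 := hb' c
    rw [sz_list_nil]
    dsimp only
    omega
  · have h1 := rowMeasure_reduceCol_le x.1
    have h2 := sz_bool_le (!(MaxLin.pivotRows x.1).isEmpty)
    rw [sz_list_cons]
    dsimp only
    omega

end InTime

end MaxLin

/-! ### Systems as lists of rows -/

namespace MaxLin

open Enc (enc)

/-- An equation as coefficient row, right-hand side and weight. -/
abbrev Row := List Bool × Bool × ℕ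

/-- A system as the number of variables in unary and the list of its rows. -/
abbrev Raw := List Unit × List Row

/-- The row of an equation. -/
def LinEq.row {n : ℕ} (e : LinEq n) : Row :=
  (List.ofFn fun i : Fin n => decide (i ∈ e.supp), decide (e.rhs = 1), e.weight)

/-- The list form of a system. -/
def LinSystem.raw (S : LinSystem) : Raw :=
  (List.replicate S.n (), List.ofFn fun j => (S.eqn j).row)

theorem LinSystem.enc_raw (S : LinSystem) : enc S.raw = S.encode := by
  simp only [enc, LinSystem.raw, LinSystem.encode, List.map_replicate, List.map_ofFn,
    Function.comp_def, LinEq.row, LinEq.encode]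

/-- The lists that come from systems. -/
def Raw.WF (R : Raw) : Prop :=
  ∀ e ∈ R.2, e.1.length = R.1.length ∧ true ∈ e.1 ∧ 0 < e.2.2

theorem LinSystem.length_raw_fst (S : LinSystem) : S.raw.1.length = S.n := by
  simp [LinSystem.raw]

theorem LinSystem.length_raw_snd (S : LinSystem) : S.raw.2.length = S.m := by
  simp [LinSystem.raw]

theorem LinSystem.forall_raw (S : LinSystem) (p : Row → Prop) :
    (∀ e ∈ S.raw.2, p e) ↔ ∀ j, p (S.eqn j).row := by
  simp [LinSystem.raw, List.mem_ofFn]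

theorem LinSystem.wf_raw (S : LinSystem) : S.raw.WF := by
  unfold Raw.WF
  rw [S.forall_raw, S.length_raw_fst]
  intro j
  refine ⟨by simp [LinEq.row], ?_, (S.eqn j).weight_pos⟩
  obtain ⟨i, hi⟩ := (S.eqn j).supp_nonempty
  simp only [LinEq.row, List.mem_ofFn]
  exact ⟨i, by simpa using hi⟩

/-- A bit as an element of GF(2). -/
def bz (b : Bool) : ZMod 2 := if b then 1 else 0

theorem bz_xor (a b : Bool) : bz (Bool.xor a b) = bz a + bz b := by
  cases a <;> cases b <;> decide

theorem bz_decide (a : ZMod 2) : bz (decide (a = 1)) = a := by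
  revert a
  decide

theorem bz_injective : Function.Injective bz := by
  intro a b
  cases a <;> cases b <;> decide

theorem Raw.WF.exists_raw_eq {R : Raw} (h : R.WF) : ∃ S : LinSystem, S.raw = R := by
  obtain ⟨l, M⟩ := R
  refine ⟨⟨l.length, M.length, fun j =>
    ⟨Finset.univ.filter fun i : Fin l.length => M[j].1.getD i false = true, ?_,
      if M[j].2.1 then 1 else 0, M[j].2.2, (h _ (List.getElem_mem j.2)).2.2⟩⟩, ?_⟩
  · obtain ⟨h1, h2, -⟩ := h _ (List.getElem_mem j.2)
    obtain ⟨i, hi, hi'⟩ := List.mem_iff_getElem.1 h2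
    exact ⟨⟨i, h1 ▸ hi⟩, by simp [hi, hi']⟩
  · refine Prod.ext ?_ ?_
    · exact (List.eq_replicate_iff.2 ⟨rfl, fun _ _ => rfl⟩).symm
    · refine List.ext_getElem (by simp [LinSystem.raw]) fun j hj hj' => ?_
      have h1 := (h _ (List.getElem_mem hj')).1
      simp only [LinSystem.raw, LinEq.row, List.getElem_ofFn]
      refine Prod.ext ?_ (Prod.ext ?_ rfl)
      · refine List.ext_getElem (by simpa using h1.symm) fun i hi hi' => ?_
        simp [List.getElem?_eq_getElem hi']
      · dsimp only
        rw [← bz_injective.eq_iff, bz_decide]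
        rfl

/-! ### Properties of systems in list form -/

theorem bz_dot_ofFn {n : ℕ} (f g : Fin n → Bool) :
    bz (dot (List.ofFn f) (List.ofFn g)) = ∑ i, if f i then bz (g i) else 0 := by
  induction n with
  | zero => simp [bz]
  | succ n ih =>
    rw [List.ofFn_succ, List.ofFn_succ, dot_cons, bz_xor, ih, Fin.sum_univ_succ]
    cases f 0 <;> simp [bz]

theorem LinEq.sum_eq_rhs_iff {n : ℕ} (e : LinEq n) (z : Fin n → Bool) :
    ∑ i ∈ e.supp, bz (z i) = e.rhs ↔ dot e.row.1 (List.ofFn z) = e.row.2.1 := by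
  rw [← bz_injective.eq_iff, LinEq.row, bz_dot_ofFn, bz_decide]
  simp

theorem exists_bits_iff {n : ℕ} (p : (Fin n → ZMod 2) → Prop) (q : List Bool → Prop)
    (h : ∀ z : Fin n → Bool, p (fun i => bz (z i)) ↔ q (List.ofFn z)) :
    (∃ z, p z) ↔ ∃ z : List Bool, z.length = n ∧ q z := by
  constructor
  · rintro ⟨z, hz⟩
    refine ⟨List.ofFn fun i => decide (z i = 1), by simp, (h _).1 ?_⟩
    simpa only [bz_decide] using hz
  · rintro ⟨z, rfl, hz⟩
    refine ⟨fun i => bz z[i], (h _).2 ?_⟩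
    simpa using hz

/-- The total weight of the rows that `z` satisfies. -/
def Raw.satWeight (R : Raw) (z : List Bool) : ℕ :=
  (R.2.map fun e => if dot e.1 z = e.2.1 then e.2.2 else 0).sum

/-- The total weight of the rows. -/
def Raw.totalWeight (R : Raw) : ℕ := (R.2.map fun e => e.2.2).sum

/-- Some assignment satisfies rows of weight at least half of the total plus `k`. -/
def Raw.AboveBound (R : Raw) (k : ℕ) : Prop :=
  ∃ z : List Bool, z.length = R.1.length ∧ R.totalWeight + 2 * k ≤ 2 * R.satWeight z

theorem LinSystem.totalWeight_raw (S : LinSystem) : S.raw.totalWeight = S.totalWeight := by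
  simp only [Raw.totalWeight, LinSystem.raw, LinSystem.totalWeight, List.map_ofFn, List.sum_ofFn]
  rfl

theorem LinSystem.aboveBound_iff (S : LinSystem) (k : ℕ+) :
    S.AboveBound k ↔ S.raw.AboveBound k := by
  unfold LinSystem.AboveBound Raw.AboveBound
  rw [S.length_raw_fst]
  refine exists_bits_iff _ _ fun z => ?_
  have h1 : S.raw.satWeight (List.ofFn z) = S.satWeight fun i => bz (z i) := by
    simp only [Raw.satWeight, LinSystem.raw, LinSystem.satWeight, List.map_ofFn, List.sum_ofFn,
      Finset.sum_filter]
    refine Finset.sum_congr rfl fun j _ => ?_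
    simp only [Function.comp_apply, ← LinEq.sum_eq_rhs_iff]
    rfl
  rw [h1, S.totalWeight_raw, div_add' _ _ _ two_ne_zero, div_le_iff₀ two_pos]
  rw [mul_comm _ (2 : ℚ), mul_comm _ (2 : ℚ)]
  exact_mod_cast Iff.rfl

/-- No coefficient row occurs twice. -/
def Raw.IsReduced (R : Raw) : Prop := (R.2.map fun e => e.1).Nodup

theorem LinSystem.isReduced_iff (S : LinSystem) : S.IsReduced ↔ S.raw.IsReduced := by
  unfold LinSystem.IsReduced Raw.IsReduced
  rw [LinSystem.raw, List.map_ofFn, List.nodup_ofFn, Function.Injective]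
  refine forall₂_congr fun j q => ?_
  rw [not_imp_comm, not_not]
  refine imp_congr ?_ Iff.rfl
  simp only [Function.comp_apply, LinEq.row, List.ofFn_inj]
  rw [Finset.ext_iff, funext_iff]
  simp

/-- Some vector has inner product one with each coefficient row. -/
def Raw.HasOddSet (R : Raw) : Prop :=
  ∃ u : List Bool, u.length = R.1.length ∧ ∀ e ∈ R.2, dot e.1 u = true

theorem LinSystem.hasOddSet_iff (S : LinSystem) : S.HasOddSet ↔ S.raw.HasOddSet := by
  have key : S.HasOddSet ↔ ∃ u : Fin S.n → ZMod 2, ∀ j, ∑ i ∈ (S.eqn j).supp, u i = 1 := by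
    constructor
    · rintro ⟨U, hU⟩
      refine ⟨fun i => if i ∈ U then 1 else 0, fun j => ?_⟩
      rw [← Finset.sum_filter, Finset.filter_mem_eq_inter, Finset.sum_const, nsmul_one]
      exact (ZMod.natCast_eq_one_iff_odd).2 (hU j)
    · rintro ⟨u, hu⟩
      refine ⟨Finset.univ.filter fun i => u i = 1, fun j => ?_⟩
      rw [← ZMod.natCast_eq_one_iff_odd, ← nsmul_one, ← Finset.sum_const,
        ← Finset.filter_mem_eq_inter, Finset.sum_filter]
      have h : ∀ a : ZMod 2, (if a = 1 then 1 else 0) = a := by decide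
      refine (Finset.sum_congr rfl fun i _ => ?_).trans (hu j)
      simp only [Finset.mem_filter, Finset.mem_univ, true_and, h]
  rw [key, Raw.HasOddSet, S.length_raw_fst]
  refine exists_bits_iff _ _ fun z => ?_
  rw [S.forall_raw]
  refine forall_congr' fun j => ?_
  rw [← bz_injective.eq_iff, LinEq.row, bz_dot_ofFn]
  simp [bz]

theorem countP_ofFn {α : Type} {n : ℕ} (f : Fin n → α) (p : α → Bool) :
    (List.ofFn f).countP p = (Finset.univ.filter fun i => p (f i) = true).card := by
  rw [Finset.card_filter]
  induction n with
  | zero => simp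
  | succ n ih =>
    rw [List.ofFn_succ, List.countP_cons, ih, Fin.sum_univ_succ, add_comm]

/-- Each row has at most `r` ones. -/
def Raw.ArityLE (r : ℕ) (R : Raw) : Prop := ∀ e ∈ R.2, e.1.count true ≤ r

theorem LinSystem.maxArity_le_iff (S : LinSystem) (r : ℕ) :
    S.maxArity ≤ r ↔ S.raw.ArityLE r := by
  rw [LinSystem.maxArity, Finset.sup_le_iff, Raw.ArityLE, S.forall_raw]
  refine forall_congr' fun j => ?_
  rw [LinEq.row, List.count, countP_ofFn]
  simp

/-- Each column has at most `ρ` ones. -/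
def Raw.OccLE (ρ : ℕ) (R : Raw) : Prop :=
  ∀ i < R.1.length, (R.2.filter fun e => e.1.getD i false).length ≤ ρ

theorem LinSystem.occurrences_le_iff (S : LinSystem) (ρ : ℕ) :
    (∀ i, S.occurrences i ≤ ρ) ↔ S.raw.OccLE ρ := by
  rw [Raw.OccLE, S.length_raw_fst, Fin.forall_iff]
  refine forall₂_congr fun i hi => ?_
  rw [← List.countP_eq_length_filter, LinSystem.raw, countP_ofFn, LinSystem.occurrences]
  simp [LinEq.row, hi]

/-! ### Restriction of a system to pivot columns -/

/-- Vectors with equal inner products are equal. -/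
theorem eq_of_forall_dot_eq {r s : List Bool} (h : r.length = s.length)
    (hd : ∀ z : List Bool, z.length = r.length → dot r z = dot s z) : r = s := by
  induction r generalizing s with
  | nil => simpa using h.symm
  | cons a r ih =>
    obtain _ | ⟨b, s⟩ := s
    · simp at h
    have h1 : r = s := ih (Nat.succ.inj h) fun z hz => by
      simpa using hd (false :: z) (by simp [hz])
    have h2 := hd (true :: List.replicate r.length false) (by simp)
    subst h1
    simp only [dot_cons, Bool.and_true, Bool.xor_left_inj] at h2
    rw [h2]

theorem dot_eq_false_of_forall_false {r : List Bool} (h : true ∉ r) (z : List Bool) :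
    dot r z = false := by
  induction r generalizing z with
  | nil => simp
  | cons a r ih =>
    cases z with
    | nil => simp
    | cons b z =>
      have h1 : a = false := by
        cases a
        · rfl
        · simp at h
      simp [h1, ih (fun h' => h (by simp [h']))]

namespace Raw

/-- The pivot columns of the coefficient matrix. -/
def mask (R : Raw) : List Bool := pivotMask R.1.length (R.2.map fun e => e.1)

/-- The system in the variables of the pivot columns, the other variables being zero. -/
def restrict (R : Raw) : Raw :=
  ((R.mask.filter fun b => b).map fun _ => (), R.2.map fun e => (sel R.mask e.1, e.2))

theorem length_mask (R : Raw) : R.mask.length = R.1.length := length_pivotMask _ _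

theorem length_restrict_fst (R : Raw) : R.restrict.1.length = R.mask.count true := by
  simp [restrict, List.count, List.countP_eq_length_filter]

theorem length_restrict_snd (R : Raw) : R.restrict.2.length = R.2.length := by
  simp [restrict]

theorem length_restrict_le (R : Raw) : R.restrict.1.length ≤ R.2.length := by
  rw [length_restrict_fst]
  exact (count_pivotMask_le _ _).trans_eq (List.length_map _)

theorem forall_restrict (R : Raw) (p : Row → Prop) :
    (∀ e ∈ R.restrict.2, p e) ↔ ∀ e ∈ R.2, p (sel R.mask e.1, e.2) :=
  List.forall_mem_map

variable {R : Raw}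

theorem WF.exists_restrict_dot_eq (h : R.WF) {z : List Bool} (hz : z.length = R.1.length) :
    ∃ y : List Bool, y.length = R.restrict.1.length ∧
      ∀ e ∈ R.2, dot (sel R.mask e.1) y = dot e.1 z := by
  obtain ⟨y, h1, h2⟩ := exists_dot_sel_pivotMask R.1.length (R.2.map fun e => e.1)
    (List.forall_mem_map.2 fun e he => (h e he).1) z hz
  refine ⟨y, h1.trans R.length_restrict_fst.symm, fun e he => h2 _ ?_⟩
  exact List.mem_map_of_mem he

theorem WF.exists_dot_eq_restrict (h : R.WF) {y : List Bool}
    (hy : y.length = R.restrict.1.length) :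
    ∃ z : List Bool, z.length = R.1.length ∧
      ∀ e ∈ R.2, dot e.1 z = dot (sel R.mask e.1) y := by
  obtain ⟨z, h1, h2⟩ := exists_dot_eq_dot_sel (hy.trans R.length_restrict_fst)
  exact ⟨z, h1.trans R.length_mask, fun e he => h2 _ ((h e he).1.trans R.length_mask.symm)⟩

theorem WF.sel_inj (h : R.WF) {e f : Row} (he : e ∈ R.2) (hf : f ∈ R.2)
    (hs : sel R.mask e.1 = sel R.mask f.1) : e.1 = f.1 := by
  refine eq_of_forall_dot_eq ((h e he).1.trans (h f hf).1.symm) fun z hz => ?_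
  obtain ⟨y, -, h2⟩ := h.exists_restrict_dot_eq (hz.trans (h e he).1)
  rw [← h2 e he, ← h2 f hf, hs]

theorem WF.restrict (h : R.WF) : R.restrict.WF := by
  unfold WF
  rw [forall_restrict]
  intro e he
  obtain ⟨h1, h2, h3⟩ := h e he
  refine ⟨(length_sel (h1.trans R.length_mask.symm)).trans R.length_restrict_fst.symm, ?_, h3⟩
  by_contra hn
  -- the row itself would be orthogonal to everything
  have h4 : e.1 = List.replicate e.1.length false := by
    refine eq_of_forall_dot_eq (by simp) fun z hz => ?_
    obtain ⟨y, -, h5⟩ := h.exists_restrict_dot_eq (hz.trans h1)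
    rw [← h5 e he, dot_eq_false_of_forall_false hn, dot_eq_false_of_forall_false (by simp)]
  rw [h4] at h2
  simp at h2

theorem WF.isReduced_restrict (h : R.WF) (hr : R.IsReduced) : R.restrict.IsReduced := by
  unfold Raw.IsReduced Raw.restrict
  rw [List.map_map]
  have h1 : R.2.Nodup := List.Nodup.of_map _ hr
  refine List.Nodup.map_on (fun e he f hf hs => ?_) h1
  exact List.inj_on_of_nodup_map hr he hf (h.sel_inj he hf hs)

theorem totalWeight_restrict : R.restrict.totalWeight = R.totalWeight := by
  simp [totalWeight, Raw.restrict, Function.comp_def]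

theorem satWeight_restrict {y z : List Bool}
    (h : ∀ e ∈ R.2, dot (sel R.mask e.1) y = dot e.1 z) :
    R.restrict.satWeight y = R.satWeight z := by
  unfold satWeight Raw.restrict
  rw [List.map_map]
  refine congrArg List.sum (List.map_congr_left fun e he => ?_)
  simp [h e he]

theorem WF.aboveBound_restrict_iff (h : R.WF) (k : ℕ) :
    R.restrict.AboveBound k ↔ R.AboveBound k := by
  constructor
  · rintro ⟨y, hy, h1⟩
    obtain ⟨z, hz, h2⟩ := h.exists_dot_eq_restrict hy
    refine ⟨z, hz, ?_⟩
    rwa [← satWeight_restrict fun e he => (h2 e he).symm, ← totalWeight_restrict]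
  · rintro ⟨z, hz, h1⟩
    obtain ⟨y, hy, h2⟩ := h.exists_restrict_dot_eq hz
    refine ⟨y, hy, ?_⟩
    rwa [satWeight_restrict h2, totalWeight_restrict]

theorem WF.hasOddSet_restrict (h : R.WF) (ho : R.HasOddSet) : R.restrict.HasOddSet := by
  obtain ⟨u, hu, hu'⟩ := ho
  obtain ⟨y, hy, h2⟩ := h.exists_restrict_dot_eq hu
  refine ⟨y, hy, (R.forall_restrict _).2 fun e he => ?_⟩
  rw [h2 e he, hu' e he]

theorem count_sel_le (m r : List Bool) : (sel m r).count true ≤ r.count true := by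
  induction r generalizing m with
  | nil => simp
  | cons a r ih =>
    obtain _ | ⟨b, m⟩ := m
    · simp [sel]
    · have := ih m
      cases a <;> cases b <;> simp <;> omega

theorem ArityLE.restrict {r : ℕ} (h : R.ArityLE r) : R.restrict.ArityLE r :=
  (R.forall_restrict _).2 fun e he => (count_sel_le _ _).trans (h e he)

/-- Each column of the restricted system is a column of the system. -/
theorem exists_getD_sel_eq {m : List Bool} {i : ℕ} (hi : i < m.count true) :
    ∃ i' < m.length, ∀ r : List Bool, r.length = m.length →
      (sel m r).getD i false = r.getD i' false := by
  induction m generalizing i with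
  | nil => simp at hi
  | cons b m ih =>
    cases b with
    | false =>
      obtain ⟨i', h1, h2⟩ := ih (i := i) (by simpa using hi)
      refine ⟨i' + 1, by simp [h1], fun r hr => ?_⟩
      obtain _ | ⟨a, r⟩ := r
      · simp at hr
      · simpa using h2 r (Nat.succ.inj hr)
    | true =>
      cases i with
      | zero =>
        refine ⟨0, by simp, fun r hr => ?_⟩
        obtain _ | ⟨a, r⟩ := r <;> simp
      | succ i =>
        obtain ⟨i', h1, h2⟩ := ih (i := i) (by simpa using hi)
        refine ⟨i' + 1, by simp [h1], fun r hr => ?_⟩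
        obtain _ | ⟨a, r⟩ := r
        · simp at hr
        · simpa using h2 r (Nat.succ.inj hr)

theorem WF.occLE_restrict (h : R.WF) {ρ : ℕ} (ho : R.OccLE ρ) : R.restrict.OccLE ρ := by
  intro i hi
  rw [length_restrict_fst] at hi
  obtain ⟨i', h1, h2⟩ := exists_getD_sel_eq hi
  rw [length_mask] at h1
  refine le_of_eq_of_le ?_ (ho i' h1)
  rw [Raw.restrict, List.filter_map, List.length_map]
  refine congrArg List.length (List.filter_congr fun e he => ?_)
  exact h2 _ ((h e he).1.trans R.length_mask.symm)

end Raw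

end MaxLin

/-! ### Characters of GF(2)-vectors and second moments -/

namespace MaxLin

/-- The nontrivial character of GF(2). -/
def sgn (a : ZMod 2) : ℝ := if a = 0 then 1 else -1

theorem zmod_two_cases (a : ZMod 2) : a = 0 ∨ a = 1 := by
  revert a
  decide

theorem sgn_zero : sgn 0 = 1 := if_pos rfl

theorem sgn_one : sgn 1 = -1 := if_neg one_ne_zero

theorem sgn_add (a b : ZMod 2) : sgn (a + b) = sgn a * sgn b := by
  have h : (1 + 1 : ZMod 2) = 0 := by decide
  rcases zmod_two_cases a with rfl | rfl <;> rcases zmod_two_cases b with rfl | rfl <;>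
    simp [sgn_zero, sgn_one, h]

theorem sgn_mul_self (a : ZMod 2) : sgn a * sgn a = 1 := by
  rcases zmod_two_cases a with rfl | rfl <;> simp [sgn_zero, sgn_one]

section Characters

variable {ι : Type} [Fintype ι] [DecidableEq ι]

/-- The character of `ι → ZMod 2` that belongs to the set `I`. -/
def chi (I : Finset ι) (z : ι → ZMod 2) : ℝ := ∏ i ∈ I, sgn (z i)

omit [Fintype ι] [DecidableEq ι] in
theorem chi_eq_sgn_sum (I : Finset ι) (z : ι → ZMod 2) : chi I z = sgn (∑ i ∈ I, z i) := by
  classical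
  induction I using Finset.induction_on with
  | empty => simp [chi, sgn_zero]
  | insert a I ha ih =>
    rw [chi, Finset.prod_insert ha, Finset.sum_insert ha, sgn_add, ← ih]
    rfl

omit [Fintype ι] [DecidableEq ι] in
theorem chi_add (I : Finset ι) (z y : ι → ZMod 2) : chi I (z + y) = chi I z * chi I y := by
  simp only [chi, Pi.add_apply, sgn_add, Finset.prod_mul_distrib]

theorem chi_symmDiff (I J : Finset ι) (z : ι → ZMod 2) :
    chi (symmDiff I J) z = chi I z * chi J z := by
  have h : ∀ K : Finset ι, chi K z = ∏ i, if i ∈ K then sgn (z i) else 1 := fun K => by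
    rw [Finset.prod_ite_mem, Finset.univ_inter]
    rfl
  rw [h, h, h, ← Finset.prod_mul_distrib]
  refine Finset.prod_congr rfl fun i _ => ?_
  by_cases h1 : i ∈ I <;> by_cases h2 : i ∈ J <;>
    simp [Finset.mem_symmDiff, h1, h2, sgn_mul_self]

theorem sum_chi_of_nonempty {I : Finset ι} (h : I.Nonempty) : ∑ z, chi I z = 0 := by
  obtain ⟨a, ha⟩ := h
  have h1 : ∑ z : ι → ZMod 2, chi I (z + Pi.single a 1) = ∑ z, chi I z :=
    Fintype.sum_equiv (Equiv.addRight (Pi.single a 1)) _ _ fun _ => rfl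
  have h2 : chi I (Pi.single a 1) = -1 := by
    rw [chi_eq_sgn_sum, Finset.sum_pi_single', if_pos ha, sgn_one]
  simp only [chi_add, h2, mul_neg, mul_one, Finset.sum_neg_distrib] at h1
  linarith

theorem sum_chi_mul_chi (I J : Finset ι) :
    ∑ z, chi I z * chi J z = if I = J then (Fintype.card (ι → ZMod 2) : ℝ) else 0 := by
  simp only [← chi_symmDiff]
  split_ifs with h
  · subst h
    simp [chi]
  · refine sum_chi_of_nonempty (Finset.nonempty_iff_ne_empty.2 fun h' => h ?_)
    exact symmDiff_eq_bot.1 h'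

/-- The second moment of a combination of characters, where characters may be repeated. -/
theorem sum_sq_sum_chi {κ : Type} [Fintype κ] (A : κ → Finset ι) (d : κ → ℝ) :
    ∑ z, (∑ j, d j * chi (A j) z) ^ 2 =
      Fintype.card (ι → ZMod 2) * ∑ j, ∑ k, if A j = A k then d j * d k else 0 := by
  have h1 : ∀ z : ι → ZMod 2, (∑ j, d j * chi (A j) z) ^ 2 =
      ∑ j, ∑ k, d j * d k * (chi (A j) z * chi (A k) z) := fun z => by
    rw [sq, Finset.sum_mul_sum]
    refine Finset.sum_congr rfl fun j _ => Finset.sum_congr rfl fun k _ => ?_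
    ring
  simp only [h1]
  rw [Finset.sum_comm, Finset.mul_sum]
  refine Finset.sum_congr rfl fun j _ => ?_
  rw [Finset.sum_comm, Finset.mul_sum]
  refine Finset.sum_congr rfl fun k _ => ?_
  rw [← Finset.mul_sum, sum_chi_mul_chi]
  split_ifs <;> ring

theorem sum_sq_sum_chi_of_injective {κ : Type} [Fintype κ] {A : κ → Finset ι}
    (hA : Function.Injective A) (d : κ → ℝ) :
    ∑ z, (∑ j, d j * chi (A j) z) ^ 2 = Fintype.card (ι → ZMod 2) * ∑ j, d j ^ 2 := by
  classical
  rw [sum_sq_sum_chi]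
  congr 1
  refine Finset.sum_congr rfl fun j _ => ?_
  simp [hA.eq_iff, sq]

/-! ### Fourth moments -/

/-- If the fourth moment is at most `b` times the square of the second moment, then a function
of mean zero is somewhere as large as a constant fraction of its standard deviation. -/
theorem sum_sq_le_of_le {Ω : Type} [Fintype Ω] (F : Ω → ℝ) {b M : ℝ} (hb : 0 < b)
    (h0 : ∑ z, F z = 0) (h4 : Fintype.card Ω * ∑ z, F z ^ 4 ≤ b * (∑ z, F z ^ 2) ^ 2)
    (hM : ∀ z, F z ≤ M) : ∑ z, F z ^ 2 ≤ 32 * b * M ^ 2 * Fintype.card Ω := by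
  set N : ℝ := (Fintype.card Ω : ℝ) with hN
  set s := ∑ z, F z ^ 2 with hs
  have hs0 : 0 ≤ s := Finset.sum_nonneg fun z _ => sq_nonneg _
  have hN0 : 0 ≤ N := Nat.cast_nonneg _
  rcases hs0.eq_or_lt with hs0 | hs0
  · rw [← hs0]
    positivity
  have hN1 : 0 < N := by
    rcases hN0.eq_or_lt with h | h
    · have : IsEmpty Ω := Fintype.card_eq_zero_iff.1 (Nat.cast_eq_zero.1 h.symm)
      simp [hs] at hs0
    · exact h
  -- the first absolute moment
  have h1 : ∑ z, |F z| ≤ 2 * M * N := by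
    have hM0 : 0 ≤ M := by
      by_contra h
      have h2 : ∑ z, F z ≤ ∑ _z : Ω, M := Finset.sum_le_sum fun z _ => hM z
      rw [h0, Finset.sum_const, Finset.card_univ, nsmul_eq_mul] at h2
      exact absurd h2 (not_le.2 (mul_neg_of_pos_of_neg hN1 (not_le.1 h)))
    calc ∑ z, |F z| ≤ ∑ z, (2 * M - F z) := Finset.sum_le_sum fun z _ =>
          abs_le.2 ⟨by linarith, by linarith [hM z]⟩
      _ = 2 * M * N := by
          rw [Finset.sum_sub_distrib, h0, Finset.sum_const, Finset.card_univ, nsmul_eq_mul]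
          ring
  set l := Real.sqrt (2 * b * s / N) with hl
  have hl2 : l ^ 2 = 2 * b * s / N := Real.sq_sqrt (by positivity)
  have hl0 : 0 ≤ l := Real.sqrt_nonneg _
  have hpt : ∀ z, l ^ 2 * F z ^ 2 - F z ^ 4 ≤ l ^ 3 * |F z| := fun z => by
    have e2 : F z ^ 2 = |F z| ^ 2 := (sq_abs _).symm
    have e4 : F z ^ 4 = |F z| ^ 4 := by rw [show 4 = 2 * 2 from rfl, pow_mul, pow_mul, e2]
    rw [e2, e4]
    have ha := abs_nonneg (F z)
    generalize |F z| = a at ha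
    have : 0 ≤ l ^ 3 - l ^ 2 * a + a ^ 3 := by
      rcases le_total a l with h | h
      · have := mul_le_mul_of_nonneg_left h (sq_nonneg l)
        have := pow_nonneg ha 3
        nlinarith
      · have := mul_le_mul_of_nonneg_right (pow_le_pow_left₀ hl0 h 2) ha
        have := pow_nonneg hl0 3
        nlinarith
    nlinarith [mul_nonneg ha this]
  have h2 : l ^ 2 * s - ∑ z, F z ^ 4 ≤ l ^ 3 * (2 * M * N) := by
    calc l ^ 2 * s - ∑ z, F z ^ 4 = ∑ z, (l ^ 2 * F z ^ 2 - F z ^ 4) := by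
          rw [Finset.sum_sub_distrib, Finset.mul_sum]
      _ ≤ ∑ z, l ^ 3 * |F z| := Finset.sum_le_sum fun z _ => hpt z
      _ = l ^ 3 * ∑ z, |F z| := (Finset.mul_sum ..).symm
      _ ≤ _ := mul_le_mul_of_nonneg_left h1 (pow_nonneg hl0 3)
  have h3 : b * s ^ 2 ≤ l ^ 3 * (2 * M * N ^ 2) := by
    have h5 := mul_le_mul_of_nonneg_left h2 hN0
    have h6 : N * (l ^ 2 * s) = 2 * b * s ^ 2 := by
      rw [hl2]
      field_simp
    nlinarith
  have h5 := pow_le_pow_left₀ (by positivity) h3 2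
  have h6 : (l ^ 3 * (2 * M * N ^ 2)) ^ 2 = 32 * b * M ^ 2 * N * (b ^ 2 * s ^ 3) := by
    rw [mul_pow, ← pow_mul, show 3 * 2 = 2 * 3 from rfl, pow_mul, hl2]
    field_simp
    ring
  rw [h6, show (b * s ^ 2) ^ 2 = s * (b ^ 2 * s ^ 3) by ring] at h5
  exact le_of_mul_le_mul_right h5 (by positivity)

/-- A multilinear polynomial in the signs of the variables from `V`. -/
def polyChi (c : Finset ι → ℝ) (V : Finset ι) (z : ι → ZMod 2) : ℝ :=
  ∑ I ∈ V.powerset, c I * chi I z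

omit [Fintype ι] in
theorem polyChi_insert (c : Finset ι → ℝ) {a : ι} {V : Finset ι} (ha : a ∉ V)
    (z : ι → ZMod 2) :
    polyChi c (insert a V) z =
      polyChi c V z + sgn (z a) * polyChi (fun I => c (insert a I)) V z := by
  rw [polyChi, Finset.sum_powerset_insert ha, polyChi, polyChi, Finset.mul_sum]
  congr 1
  refine Finset.sum_congr rfl fun I hI => ?_
  rw [chi, Finset.prod_insert fun h => ha (Finset.mem_powerset.1 hI h), chi]
  ring

omit [Fintype ι] in
theorem polyChi_add_single (c : Finset ι → ℝ) {a : ι} {V : Finset ι} (ha : a ∉ V)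
    (z : ι → ZMod 2) : polyChi c V (z + Pi.single a 1) = polyChi c V z := by
  refine Finset.sum_congr rfl fun I hI => ?_
  rw [chi_add, chi_eq_sgn_sum I (Pi.single a 1), Finset.sum_pi_single',
    if_neg fun h => ha (Finset.mem_powerset.1 hI h), sgn_zero, mul_one]

/-- Averaging over the two values of a sign that `G` and `H` do not depend on. -/
theorem sum_add_sgn_mul {G H : (ι → ZMod 2) → ℝ} {a : ι}
    (hG : ∀ z, G (z + Pi.single a 1) = G z) (hH : ∀ z, H (z + Pi.single a 1) = H z) :
    ∑ z, (G z + sgn (z a) * H z) ^ 2 = ∑ z, G z ^ 2 + ∑ z, H z ^ 2 ∧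
    ∑ z, (G z + sgn (z a) * H z) ^ 4 =
      ∑ z, G z ^ 4 + 6 * ∑ z, G z ^ 2 * H z ^ 2 + ∑ z, H z ^ 4 := by
  have key : ∀ k : ℕ, 2 * ∑ z, (G z + sgn (z a) * H z) ^ k =
      ∑ z, ((G z + H z) ^ k + (G z - H z) ^ k) := fun k => by
    have h1 : ∑ z, (G z + sgn (z a) * H z) ^ k =
        ∑ z, (G z + sgn ((z + Pi.single a 1 : ι → ZMod 2) a) * H z) ^ k := by
      refine (Fintype.sum_equiv (Equiv.addRight (Pi.single a 1)) _ _ fun z => ?_).symm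
      simp only [Equiv.coe_addRight, hG, hH]
    rw [two_mul]
    nth_rewrite 2 [h1]
    rw [← Finset.sum_add_distrib]
    refine Finset.sum_congr rfl fun z _ => ?_
    rw [Pi.add_apply, sgn_add, Pi.single_eq_same, sgn_one]
    rcases zmod_two_cases (z a) with h | h <;> rw [h]
    · rw [sgn_zero]
      ring
    · rw [sgn_one]
      ring
  constructor
  · have h := key 2
    have e : ∑ z, ((G z + H z) ^ 2 + (G z - H z) ^ 2) = 2 * (∑ z, G z ^ 2 + ∑ z, H z ^ 2) := by
      rw [← Finset.sum_add_distrib, Finset.mul_sum]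
      exact Finset.sum_congr rfl fun z _ => by ring
    linarith
  · have h := key 4
    have e : ∑ z, ((G z + H z) ^ 4 + (G z - H z) ^ 4) =
        2 * (∑ z, G z ^ 4 + 6 * ∑ z, G z ^ 2 * H z ^ 2 + ∑ z, H z ^ 4) := by
      rw [Finset.mul_sum, ← Finset.sum_add_distrib, ← Finset.sum_add_distrib, Finset.mul_sum]
      exact Finset.sum_congr rfl fun z _ => by ring
    linarith

/-- Bonami's inequality: the fourth moment of a multilinear polynomial of degree `r` in signs is
at most `9 ^ r` times the square of its second moment. -/
theorem sum_polyChi_pow_four_le (V : Finset ι) (r : ℕ) (c : Finset ι → ℝ)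
    (hc : ∀ I ⊆ V, r < I.card → c I = 0) :
    Fintype.card (ι → ZMod 2) * ∑ z, polyChi c V z ^ 4 ≤
      9 ^ r * (∑ z, polyChi c V z ^ 2) ^ 2 := by
  induction V using Finset.induction_on generalizing r c with
  | empty =>
    have h9 : (1 : ℝ) ≤ 9 ^ r := one_le_pow₀ (by norm_num)
    simp only [polyChi, Finset.powerset_empty, Finset.sum_singleton, chi, Finset.prod_empty,
      mul_one, Finset.sum_const, nsmul_eq_mul, Finset.card_univ]
    refine le_of_eq_of_le ?_ (le_mul_of_one_le_left (sq_nonneg _) h9)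
    ring
  | insert a V ha ih =>
    obtain ⟨e2, e4⟩ := sum_add_sgn_mul (polyChi_add_single c ha)
      (polyChi_add_single (fun I => c (insert a I)) ha)
    simp only [polyChi_insert c ha]
    rw [e2, e4]
    have hG := ih r c fun I hI => hc I (hI.trans (Finset.subset_insert a V))
    cases r with
    | zero =>
      have hH : ∀ z, polyChi (fun I => c (insert a I)) V z = 0 := fun z => by
        refine Finset.sum_eq_zero fun I hI => ?_
        have h0 := hc _ (Finset.insert_subset_insert a (Finset.mem_powerset.1 hI))
          (Finset.card_pos.2 ⟨a, by simp⟩)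
        exact mul_eq_zero_of_left h0 _
      simpa [hH] using hG
    | succ r =>
      have hH := ih r (fun I => c (insert a I)) fun I hI hr => by
        refine hc _ (Finset.insert_subset_insert a hI) ?_
        rw [Finset.card_insert_of_notMem fun h => ha (hI h)]
        omega
      have hCS := Finset.sum_mul_sq_le_sq_mul_sq Finset.univ (fun z => polyChi c V z ^ 2)
        fun z => polyChi (fun I => c (insert a I)) V z ^ 2
      simp only [← pow_mul, Nat.reduceMul] at hCS
      have hK : (0 : ℝ) < 9 ^ r := by positivity
      have hg : 0 ≤ ∑ z, polyChi c V z ^ 2 := Finset.sum_nonneg fun z _ => sq_nonneg _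
      have hh : 0 ≤ ∑ z, polyChi (fun I => c (insert a I)) V z ^ 2 :=
        Finset.sum_nonneg fun z _ => sq_nonneg _
      have hg4 : 0 ≤ ∑ z, polyChi c V z ^ 4 := Finset.sum_nonneg fun z _ => by positivity
      have hh4 : 0 ≤ ∑ z, polyChi (fun I => c (insert a I)) V z ^ 4 :=
        Finset.sum_nonneg fun z _ => by positivity
      have hN : (0 : ℝ) ≤ Fintype.card (ι → ZMod 2) := Nat.cast_nonneg _
      rw [pow_succ] at hG ⊢
      generalize (Fintype.card (ι → ZMod 2) : ℝ) = N at *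
      generalize (9 : ℝ) ^ r = K at *
      generalize ∑ z, polyChi c V z ^ 2 = g at *
      generalize ∑ z, polyChi (fun I => c (insert a I)) V z ^ 2 = h at *
      generalize ∑ z, polyChi c V z ^ 4 = g4 at *
      generalize ∑ z, polyChi (fun I => c (insert a I)) V z ^ 4 = h4 at *
      generalize ∑ z, polyChi c V z ^ 2 * polyChi (fun I => c (insert a I)) V z ^ 2 = m at *
      have hm : N * m ≤ 3 * K * g * h := by
        refine abs_le_of_sq_le_sq' (?_ : (N * m) ^ 2 ≤ _) (by positivity) |>.2
        calc (N * m) ^ 2 = N ^ 2 * m ^ 2 := by ring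
          _ ≤ N ^ 2 * (g4 * h4) := mul_le_mul_of_nonneg_left hCS (sq_nonneg N)
          _ = (N * g4) * (N * h4) := by ring
          _ ≤ (K * 9 * g ^ 2) * (K * h ^ 2) :=
              mul_le_mul hG hH (by positivity) (by positivity)
          _ = (3 * K * g * h) ^ 2 := by ring
      have : 0 ≤ K * h ^ 2 := by positivity
      nlinarith

/-- A combination of distinct characters of degree at most `r` is hypercontractive. -/
theorem sum_pow_four_le_of_card_le {κ : Type} [Fintype κ] {A : κ → Finset ι}
    (d : κ → ℝ) {r : ℕ} (hr : ∀ j, (A j).card ≤ r) :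
    Fintype.card (ι → ZMod 2) * ∑ z, (∑ j, d j * chi (A j) z) ^ 4 ≤
      9 ^ r * (∑ z, (∑ j, d j * chi (A j) z) ^ 2) ^ 2 := by
  have h := sum_polyChi_pow_four_le Finset.univ r (fun I => ∑ j with A j = I, d j) ?_
  · have e : ∀ z, polyChi (fun I => ∑ j with A j = I, d j) Finset.univ z =
        ∑ j, d j * chi (A j) z := fun z => by
      rw [polyChi, Finset.powerset_univ, ← Finset.sum_fiberwise Finset.univ A]
      refine Finset.sum_congr rfl fun I _ => ?_
      rw [Finset.sum_mul]
      refine Finset.sum_congr rfl fun j hj => ?_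
      rw [(Finset.mem_filter.1 hj).2]
    simpa only [e] using h
  · intro I _ hI
    refine Finset.sum_eq_zero fun j hj => ?_
    rw [← (Finset.mem_filter.1 hj).2] at hI
    exact absurd (hr j) (not_le.2 hI)

omit [Fintype ι] in
/-- If each variable occurs in at most `ρ` of the distinct sets `A j`, then a nonempty set `D` is
the symmetric difference of at most `2 ρ` pairs of them: for a fixed variable of `D`, one member of
the pair contains it, and this member determines the other one. -/
theorem card_symmDiff_eq_le {κ : Type} [Fintype κ] [DecidableEq κ] {A : κ → Finset ι}
    (hA : Function.Injective A) {ρ : ℕ}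
    (hρ : ∀ i, (Finset.univ.filter fun j => i ∈ A j).card ≤ ρ) {D : Finset ι} (hD : D.Nonempty) :
    (Finset.univ.filter fun p : κ × κ => symmDiff (A p.1) (A p.2) = D).card ≤ 2 * ρ := by
  obtain ⟨i, hi⟩ := hD
  have hsub : (Finset.univ.filter fun p : κ × κ => symmDiff (A p.1) (A p.2) = D) ⊆
      (Finset.univ.filter fun p : κ × κ => symmDiff (A p.1) (A p.2) = D ∧ i ∈ A p.1) ∪
      (Finset.univ.filter fun p : κ × κ => symmDiff (A p.1) (A p.2) = D ∧ i ∈ A p.2) := by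
    intro p hp
    have h1 := (Finset.mem_filter.1 hp).2
    have h2 := hi
    rw [← h1, Finset.mem_symmDiff] at h2
    simp only [Finset.mem_union, Finset.mem_filter, Finset.mem_univ, true_and, h1]
    tauto
  refine (Finset.card_le_card hsub).trans ((Finset.card_union_le _ _).trans ?_)
  rw [two_mul]
  refine add_le_add ((Finset.card_le_card_of_injOn Prod.fst ?_ ?_).trans (hρ i))
    ((Finset.card_le_card_of_injOn Prod.snd ?_ ?_).trans (hρ i))
  · intro p hp
    simp at hp ⊢
    exact hp.2
  · rintro ⟨p, q⟩ hp ⟨p', q'⟩ hp' (rfl : p = p')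
    simp only [Finset.coe_filter, Finset.mem_univ, true_and, Set.mem_ofPred_eq] at hp hp'
    rw [hA (symmDiff_right_injective _ (hp.1.trans hp'.1.symm))]
  · intro p hp
    simp at hp ⊢
    exact hp.2
  · rintro ⟨p, q⟩ hp ⟨p', q'⟩ hp' (rfl : q = q')
    simp only [Finset.coe_filter, Finset.mem_univ, true_and, Set.mem_ofPred_eq] at hp hp'
    rw [hA (symmDiff_left_injective _ (hp.1.trans hp'.1.symm))]

/-- The fourth moment of a combination of distinct characters in which each variable occurs at
most `ρ` times. The square of the combination is again a combination of characters, of which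
each nontrivial one comes from at most `2 ρ` pairs. -/
theorem sum_pow_four_le_of_occurrences_le {κ : Type} [Fintype κ] {A : κ → Finset ι}
    (hA : Function.Injective A) (d : κ → ℝ) {ρ : ℕ}
    (hρ : ∀ i, (Finset.univ.filter fun j => i ∈ A j).card ≤ ρ) :
    Fintype.card (ι → ZMod 2) * ∑ z, (∑ j, d j * chi (A j) z) ^ 4 ≤
      (2 * ρ + 1) * (∑ z, (∑ j, d j * chi (A j) z) ^ 2) ^ 2 := by
  classical
  set N : ℝ := (Fintype.card (ι → ZMod 2) : ℝ)
  have h1 : ∀ z : ι → ZMod 2, (∑ j, d j * chi (A j) z) ^ 4 =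
      (∑ p : κ × κ, d p.1 * d p.2 * chi (symmDiff (A p.1) (A p.2)) z) ^ 2 := fun z => by
    rw [show 4 = 2 * 2 from rfl, pow_mul, sq (∑ j, d j * chi (A j) z), Finset.sum_mul_sum,
      Fintype.sum_prod_type]
    congr 1
    refine Finset.sum_congr rfl fun j _ => Finset.sum_congr rfl fun k _ => ?_
    rw [chi_symmDiff]
    ring
  simp only [h1]
  rw [sum_sq_sum_chi fun p : κ × κ => symmDiff (A p.1) (A p.2), sum_sq_sum_chi_of_injective hA]
  set v := ∑ j, d j ^ 2 with hv
  set D : κ × κ → Finset ι := fun p => symmDiff (A p.1) (A p.2) with hD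
  set e : κ × κ → ℝ := fun p => d p.1 * d p.2 with he
  have hDe : ∀ p, D p = ∅ ↔ p.1 = p.2 := fun p => by
    rw [hD, ← Finset.bot_eq_empty]
    exact symmDiff_eq_bot.trans hA.eq_iff
  have hev : ∑ p, e p ^ 2 = v ^ 2 := by
    rw [Fintype.sum_prod_type, sq v, hv, Finset.sum_mul_sum]
    exact Finset.sum_congr rfl fun j _ => Finset.sum_congr rfl fun k _ => mul_pow _ _ _
  have hempty : ∑ p, ∑ q, (if D p = ∅ ∧ D q = ∅ then e p * e q else 0) = v ^ 2 := by
    have h2 : ∀ p q, (if D p = ∅ ∧ D q = ∅ then e p * e q else 0) =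
        (if p.1 = p.2 then e p else 0) * (if q.1 = q.2 then e q else 0) := fun p q => by
      simp only [hDe]
      split_ifs <;> simp_all
    simp only [h2]
    rw [← Finset.sum_mul_sum, ← sq, Fintype.sum_prod_type]
    simp [he, hv, sq]
  have hne : ∑ p, ∑ q, (if D p = D q ∧ D p ≠ ∅ then e p * e q else 0) ≤ 2 * ρ * v ^ 2 := by
    have h2 : ∀ p q, (if D p = D q ∧ D p ≠ ∅ then e p * e q else 0) ≤
        (if D p = D q ∧ D p ≠ ∅ then e p ^ 2 / 2 else 0) +
          (if D q = D p ∧ D q ≠ ∅ then e q ^ 2 / 2 else 0) := fun p q => by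
      by_cases h : D p = D q ∧ D p ≠ ∅
      · rw [if_pos h, if_pos h, if_pos ⟨h.1.symm, h.1 ▸ h.2⟩]
        nlinarith [sq_nonneg (e p - e q)]
      · rw [if_neg h, if_neg h, if_neg, add_zero]
        exact fun h' => h ⟨h'.1.symm, h'.1 ▸ h'.2⟩
    have h3 : ∀ p, ∑ q, (if D p = D q ∧ D p ≠ ∅ then e p ^ 2 / 2 else 0) ≤ ρ * e p ^ 2 :=
        fun p => by
      by_cases h : D p = ∅
      · simp only [h, ne_eq, not_true_eq_false, and_false, if_false, Finset.sum_const_zero]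
        positivity
      · simp only [ne_eq, h, not_false_eq_true, and_true]
        rw [← Finset.sum_filter, Finset.sum_const, nsmul_eq_mul]
        have h4 := card_symmDiff_eq_le hA hρ (Finset.nonempty_iff_ne_empty.2 h)
        have h5 : (Finset.univ.filter fun q => D p = D q) =
            Finset.univ.filter fun q : κ × κ => symmDiff (A q.1) (A q.2) = D p := by
          ext q
          simp [hD, eq_comm]
        rw [h5]
        have h6 : ((Finset.univ.filter fun q : κ × κ =>
            symmDiff (A q.1) (A q.2) = D p).card : ℝ) ≤ 2 * ρ := by exact_mod_cast h4
        nlinarith [sq_nonneg (e p)]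
    calc ∑ p, ∑ q, (if D p = D q ∧ D p ≠ ∅ then e p * e q else 0)
        ≤ ∑ p, ∑ q, ((if D p = D q ∧ D p ≠ ∅ then e p ^ 2 / 2 else 0) +
          (if D q = D p ∧ D q ≠ ∅ then e q ^ 2 / 2 else 0)) :=
          Finset.sum_le_sum fun p _ => Finset.sum_le_sum fun q _ => h2 p q
      _ = ∑ p, ∑ q, (if D p = D q ∧ D p ≠ ∅ then e p ^ 2 / 2 else 0) +
          ∑ p, ∑ q, (if D p = D q ∧ D p ≠ ∅ then e p ^ 2 / 2 else 0) := by
          simp only [Finset.sum_add_distrib]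
          congr 1
          exact Finset.sum_comm
      _ ≤ ∑ p, ρ * e p ^ 2 + ∑ p, ρ * e p ^ 2 :=
          add_le_add (Finset.sum_le_sum fun p _ => h3 p) (Finset.sum_le_sum fun p _ => h3 p)
      _ = 2 * ρ * v ^ 2 := by
          rw [← Finset.mul_sum, hev]
          ring
  have hsplit : ∑ p, ∑ q, (if D p = D q then e p * e q else 0) =
      ∑ p, ∑ q, (if D p = ∅ ∧ D q = ∅ then e p * e q else 0) +
      ∑ p, ∑ q, (if D p = D q ∧ D p ≠ ∅ then e p * e q else 0) := by
    simp only [← Finset.sum_add_distrib]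
    refine Finset.sum_congr rfl fun p _ => Finset.sum_congr rfl fun q _ => ?_
    by_cases h : D p = ∅
    · by_cases h' : D q = ∅
      · simp [h, h']
      · simp [h, h', Ne.symm h']
    · simp [h]
  rw [hsplit, hempty]
  have hN : 0 ≤ N ^ 2 := sq_nonneg N
  nlinarith [mul_le_mul_of_nonneg_left hne hN]

end Characters

/-! ### Systems with large weights are yes-instances -/

namespace LinSystem

variable (S : LinSystem)

/-- The weight of the satisfied equations minus the weight of the others. -/
noncomputable def excess (z : Fin S.n → ZMod 2) : ℝ :=
  ∑ j, ((S.eqn j).weight * sgn (S.eqn j).rhs) * chi (S.eqn j).supp z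

theorem excess_eq (z : Fin S.n → ZMod 2) :
    S.excess z = 2 * S.satWeight z - S.totalWeight := by
  rw [excess, satWeight, totalWeight, Finset.sum_filter]
  push_cast
  rw [Finset.mul_sum, ← Finset.sum_sub_distrib]
  refine Finset.sum_congr rfl fun j _ => ?_
  rw [chi_eq_sgn_sum, mul_assoc, ← sgn_add]
  generalize ∑ i ∈ (S.eqn j).supp, z i = a
  generalize (S.eqn j).rhs = b
  have h : (1 + 1 : ZMod 2) = 0 := by decide
  rcases zmod_two_cases a with rfl | rfl <;> rcases zmod_two_cases b with rfl | rfl <;>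
    simp [sgn_zero, sgn_one, h] <;> ring

variable {S}

theorem excess_le_of_not_aboveBound {k : ℕ+} (h : ¬S.AboveBound k) (z : Fin S.n → ZMod 2) :
    S.excess z ≤ 2 * (k : ℕ) := by
  rw [AboveBound, not_exists] at h
  have h1 := not_le.1 (h z)
  have h2 : (2 * S.satWeight z : ℚ) < S.totalWeight + 2 * (k : ℕ) := by linarith
  have h3 : (2 * S.satWeight z : ℝ) < S.totalWeight + 2 * (k : ℕ) := by exact_mod_cast h2
  rw [excess_eq]
  linarith

theorem IsReduced.injective (h : S.IsReduced) : Function.Injective fun j => (S.eqn j).supp :=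
  fun j q => not_imp_not.1 (h j q)

theorem IsReduced.sum_excess_sq (h : S.IsReduced) :
    ∑ z, S.excess z ^ 2 =
      Fintype.card (Fin S.n → ZMod 2) * ((∑ j, (S.eqn j).weight ^ 2 : ℕ) : ℝ) := by
  simp only [excess]
  rw [sum_sq_sum_chi_of_injective h.injective]
  congr 1
  push_cast
  refine Finset.sum_congr rfl fun j _ => ?_
  rw [mul_pow, sq (sgn _), sgn_mul_self, mul_one]

theorem sum_excess : ∑ z, S.excess z = 0 := by
  simp only [excess]
  rw [Finset.sum_comm]
  refine Finset.sum_eq_zero fun j _ => ?_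
  rw [← Finset.mul_sum, sum_chi_of_nonempty (S.eqn j).supp_nonempty, mul_zero]

/-- With an odd set of variables, the excess changes its sign when these variables are flipped,
so its maximum is at least its standard deviation. -/
theorem IsReduced.sum_weight_sq_le_of_hasOddSet (h : S.IsReduced) (ho : S.HasOddSet) {k : ℕ+}
    (hk : ¬S.AboveBound k) : ∑ j, (S.eqn j).weight ^ 2 ≤ 4 * (k : ℕ) ^ 2 := by
  obtain ⟨U, hU⟩ := ho
  have hflip : ∀ z, S.excess (z + fun i => if i ∈ U then 1 else 0) = -S.excess z := fun z => by
    rw [excess, excess, ← Finset.sum_neg_distrib]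
    refine Finset.sum_congr rfl fun j _ => ?_
    rw [chi_add, chi_eq_sgn_sum _ fun i => if i ∈ U then 1 else 0, ← Finset.sum_filter,
      Finset.filter_mem_eq_inter, Finset.sum_const, nsmul_one,
      ZMod.natCast_eq_one_iff_odd.2 (hU j), sgn_one]
    ring
  have hM : ∀ z, S.excess z ^ 2 ≤ (2 * (k : ℕ)) ^ 2 := fun z => by
    refine sq_le_sq' ?_ (excess_le_of_not_aboveBound hk z)
    have := excess_le_of_not_aboveBound hk (z + fun i => if i ∈ U then 1 else 0)
    rw [hflip] at this
    linarith
  have h1 : ∑ z, S.excess z ^ 2 ≤ ∑ _z : Fin S.n → ZMod 2, (2 * (k : ℕ) : ℝ) ^ 2 :=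
    Finset.sum_le_sum fun z _ => hM z
  rw [h.sum_excess_sq, Finset.sum_const, Finset.card_univ, nsmul_eq_mul] at h1
  have h2 := le_of_mul_le_mul_left h1 (Nat.cast_pos.2 Fintype.card_pos)
  have h3 : ((∑ j, (S.eqn j).weight ^ 2 : ℕ) : ℝ) ≤ ((4 * (k : ℕ) ^ 2 : ℕ) : ℝ) := by
    refine h2.trans_eq ?_
    push_cast
    ring
  exact_mod_cast h3

theorem IsReduced.sum_weight_sq_le_of_moment (h : S.IsReduced) {b : ℕ} (hb : 0 < b)
    (h4 : Fintype.card (Fin S.n → ZMod 2) * ∑ z, S.excess z ^ 4 ≤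
      b * (∑ z, S.excess z ^ 2) ^ 2) {k : ℕ+} (hk : ¬S.AboveBound k) :
    ∑ j, (S.eqn j).weight ^ 2 ≤ 128 * b * (k : ℕ) ^ 2 := by
  have h1 := sum_sq_le_of_le S.excess (Nat.cast_pos.2 hb) sum_excess h4
    (excess_le_of_not_aboveBound hk)
  rw [h.sum_excess_sq, mul_comm] at h1
  have h2 := le_of_mul_le_mul_right h1 (Nat.cast_pos.2 Fintype.card_pos)
  have h3 : ((∑ j, (S.eqn j).weight ^ 2 : ℕ) : ℝ) ≤ ((128 * b * (k : ℕ) ^ 2 : ℕ) : ℝ) := by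
    refine h2.trans_eq ?_
    push_cast
    ring
  exact_mod_cast h3

theorem IsReduced.sum_weight_sq_le_of_maxArity (h : S.IsReduced) {r : ℕ} (hr : S.maxArity ≤ r)
    {k : ℕ+} (hk : ¬S.AboveBound k) :
    ∑ j, (S.eqn j).weight ^ 2 ≤ 128 * 9 ^ r * (k : ℕ) ^ 2 := by
  refine h.sum_weight_sq_le_of_moment (by positivity) ?_ hk
  push_cast
  exact sum_pow_four_le_of_card_le _ fun j => Finset.sup_le_iff.1 hr j (Finset.mem_univ j)

theorem IsReduced.sum_weight_sq_le_of_occurrences (h : S.IsReduced) {ρ : ℕ}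
    (hρ : ∀ i, S.occurrences i ≤ ρ) {k : ℕ+} (hk : ¬S.AboveBound k) :
    ∑ j, (S.eqn j).weight ^ 2 ≤ 128 * (2 * ρ + 1) * (k : ℕ) ^ 2 := by
  refine h.sum_weight_sq_le_of_moment (by positivity) ?_ hk
  push_cast
  exact sum_pow_four_le_of_occurrences_le h.injective _ hρ

end LinSystem

end MaxLin

/-! ### Polynomial-time tests -/

namespace MaxLin

open Enc (enc)

namespace Raw

/-- Test whether no coefficient row occurs twice. -/
def reducedTest (R : Raw) : Bool :=
  (R.2.map fun e => e.1).all fun r =>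
    ((R.2.map fun e => e.1).filter fun s => (xorL r s).all fun b => !b).tail.isEmpty

/-- Test for an odd set: solve the system whose right-hand sides are all one. -/
def oddTest (R : Raw) : Bool :=
  (elimRows R.1.length (R.2.map fun e => e.1 ++ [true])).all fun r => !r.headD false

/-- Test whether each row has at most `r` ones. -/
def arityTest (r : ℕ) (R : Raw) : Bool :=
  R.2.all fun e => ((e.1.filter fun b => b).drop (List.replicate r ()).length).isEmpty

/-- Test whether each column has at most `ρ` ones. -/
def occTest (ρ : ℕ) (R : Raw) : Bool :=
  (R.1.foldl (fun (x : List (List Bool) × Bool) _ =>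
    (x.1.map List.tail,
      x.2 && ((pivotRows x.1).drop (List.replicate ρ ()).length).isEmpty))
    (R.2.map fun e => e.1, true)).2

variable {R : Raw}

theorem xorL_all_not_iff {r s : List Bool} (h : r.length = s.length) :
    ((xorL r s).all fun b => !b) = true ↔ r = s := by
  induction r generalizing s with
  | nil =>
    obtain rfl : s = [] := by simpa using h.symm
    simp
  | cons a r ih =>
    obtain _ | ⟨b, s⟩ := s
    · simp at h
    rw [xorL_cons, List.all_cons, Bool.and_eq_true, ih (Nat.succ.inj h), List.cons.injEq]
    cases a <;> cases b <;> simp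

theorem WF.reducedTest_iff (h : R.WF) : R.reducedTest = true ↔ R.IsReduced := by
  have hl : ∀ r ∈ R.2.map fun e => e.1, r.length = R.1.length :=
    List.forall_mem_map.2 fun e he => (h e he).1
  rw [reducedTest, List.all_eq_true, IsReduced, List.nodup_iff_count_le_one]
  generalize (R.2.map fun e => e.1) = L at hl
  have key : ∀ r ∈ L, (L.filter fun s => (xorL r s).all fun b => !b).tail.isEmpty = true ↔
      L.count r ≤ 1 := fun r hr => by
    rw [List.isEmpty_iff_length_eq_zero, List.length_tail, List.count,
      List.countP_eq_length_filter, List.filter_congr (q := fun s => s == r) fun s hs => ?_]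
    · omega
    · rw [Bool.eq_iff_iff, xorL_all_not_iff ((hl r hr).trans (hl s hs).symm), beq_iff_eq, eq_comm]
  constructor
  · intro h1 r
    by_cases hr : r ∈ L
    · exact (key r hr).1 (h1 r hr)
    · rw [List.count_eq_zero_of_not_mem hr]
      exact Nat.zero_le _
  · exact fun h1 r hr => (key r hr).2 (h1 r)

theorem dot_append_true {r z : List Bool} (h : r.length = z.length) :
    dot (r ++ [true]) (z ++ [true]) = !dot r z := by
  induction r generalizing z with
  | nil =>
    obtain rfl : z = [] := by simpa using h.symm
    simp
  | cons a r ih =>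
    obtain _ | ⟨b, z⟩ := z
    · simp at h
    simp [ih (Nat.succ.inj h)]

theorem dot_singleton_true (r : List Bool) : dot r [true] = r.headD false := by
  cases r <;> simp

theorem WF.oddTest_iff (h : R.WF) : R.oddTest = true ↔ R.HasOddSet := by
  have h1 := exists_dot_append_eq_false_iff R.1.length (R.2.map fun e => e.1 ++ [true]) [true]
    (List.forall_mem_map.2 fun e he => by simp [(h e he).1])
  rw [oddTest, List.all_eq_true, HasOddSet]
  simp only [Bool.not_eq_true', ← dot_singleton_true]
  rw [← h1]
  refine exists_congr fun z => and_congr_right fun hz => ?_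
  rw [List.forall_mem_map]
  refine forall₂_congr fun e he => ?_
  rw [dot_append_true ((h e he).1.trans hz.symm), Bool.not_eq_false']

theorem arityTest_iff {r : ℕ} : R.arityTest r = true ↔ R.ArityLE r := by
  rw [arityTest, List.all_eq_true, ArityLE]
  refine forall₂_congr fun e _ => ?_
  rw [List.isEmpty_iff_length_eq_zero, List.length_drop, List.length_replicate, List.count,
    List.countP_eq_length_filter, Nat.sub_eq_zero_iff_le]
  simp

theorem occTest_aux (ρ : ℕ) (l : List Unit) (M : List (List Bool)) (b : Bool) :
    (l.foldl (fun (x : List (List Bool) × Bool) _ =>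
      (x.1.map List.tail,
        x.2 && ((pivotRows x.1).drop (List.replicate ρ ()).length).isEmpty)) (M, b)).2 = true ↔
    b = true ∧ ∀ i < l.length, (M.filter fun r => r.getD i false).length ≤ ρ := by
  induction l generalizing M b with
  | nil => simp
  | cons a l ih =>
    rw [List.foldl_cons, ih, Bool.and_eq_true, and_assoc]
    refine and_congr_right fun _ => ?_
    rw [List.length_cons, Nat.forall_lt_succ_left, List.isEmpty_iff_length_eq_zero,
      List.length_drop, List.length_replicate, Nat.sub_eq_zero_iff_le]
    refine and_congr (Iff.of_eq (congrArg (· ≤ ρ) (congrArg List.length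
      (List.filter_congr fun r _ => ?_)))) (forall₂_congr fun i _ => ?_)
    · cases r <;> rfl
    · rw [List.filter_map, List.length_map]
      refine Iff.of_eq (congrArg (· ≤ ρ) (congrArg List.length (List.filter_congr fun r _ => ?_)))
      cases r <;> rfl

theorem occTest_iff {ρ : ℕ} : R.occTest ρ = true ↔ R.OccLE ρ := by
  rw [occTest, occTest_aux, OccLE]
  simp only [true_and, List.filter_map, List.length_map]
  rfl

end Raw

/-- Every second element of a list of units. -/
def halve (L : List Unit) : List Unit :=
  (L.foldl (fun (x : Bool × List Unit) a => bif x.1 then (false, a :: x.2) else (true, x.2))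
    (false, [])).2

theorem length_halve (L : List Unit) : (halve L).length = L.length / 2 := by
  have key : ∀ (L : List Unit) (x : Bool × List Unit), (L.foldl (fun (x : Bool × List Unit) a =>
      bif x.1 then (false, a :: x.2) else (true, x.2)) x).2.length =
      x.2.length + (L.length + x.1.toNat) / 2 := by
    intro L
    induction L with
    | nil => rintro ⟨_ | _, y⟩ <;> simp
    | cons a L ih =>
      rintro ⟨_ | _, y⟩
      · rw [List.foldl_cons, ih]
        simp
      · rw [List.foldl_cons, ih]
        simp
        omega
  rw [halve, key]
  simp

theorem sz_units (L : List Unit) : sz L = 2 * L.length + 1 := by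
  induction L with
  | nil => rfl
  | cons a L ih => rw [sz_list_cons, sz_unit, ih, List.length_cons]; omega

/-- Divide the length of a list by four as often as `kb` has elements. -/
def shrink (L : List Unit) (kb : List Bool) : List Unit :=
  kb.foldl (fun L _ => halve (halve L)) L

theorem length_shrink (L : List Unit) (kb : List Bool) :
    (shrink L kb).length = L.length / 4 ^ kb.length := by
  induction kb generalizing L with
  | nil => simp [shrink]
  | cons b kb ih =>
    have := ih (halve (halve L))
    rw [shrink] at this ⊢
    rw [List.foldl_cons, this, length_halve, length_halve, Nat.div_div_eq_div_mul,
      Nat.div_div_eq_div_mul, List.length_cons, pow_succ', ← mul_assoc, show 2 * 2 = 4 from rfl]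

/-- Test for many equations, or an equation of large weight, in comparison with `k`. Numbers are
compared up to constant factors, by the lengths of their binary representations. -/
def Raw.yesTest (D : ℕ) (R : Raw) (k : ℕ) : Bool :=
  !((shrink (R.2.map fun _ => ()) k.bits).drop (List.replicate D ()).length).isEmpty ||
  R.2.any fun e => !((e.2.2.bits.drop k.bits.length).drop (List.replicate D ()).length).isEmpty

theorem Raw.yesTest_iff {D : ℕ} {R : Raw} {k : ℕ} : R.yesTest D k = true ↔
    (D + 1) * 4 ^ k.size ≤ R.2.length ∨ ∃ e ∈ R.2, k.size + D < e.2.2.size := by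
  simp only [Raw.yesTest, Bool.or_eq_true, List.any_eq_true, Bool.not_eq_true',
    ← Bool.not_eq_true, List.isEmpty_iff_length_eq_zero, List.length_drop, List.length_replicate,
    Nat.sub_eq_zero_iff_le, not_le, Nat.size_eq_bits_len, length_shrink, List.length_map]
  refine or_congr ?_ (exists_congr fun e => and_congr_right fun _ => ?_)
  · rw [Nat.lt_iff_add_one_le, Nat.le_div_iff_mul_le (by positivity)]
  · omega

/-! ### Running time of the tests -/

namespace InTime

variable {B : (ℕ → ℕ) → Prop} {γ : Type} [Enc γ]

theorem bits {f : γ → ℕ} (hf : InTime B f) : InTime B fun c => (f c).bits :=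
  hf.congr_enc (fun a => a) (fun _ => rfl) fun _ => rfl

variable [TimeClass B]

theorem coeffs {R : γ → Raw} (hR : InTime B R) : InTime B fun c => (R c).2.map fun e => e.1 :=
  hR.snd.map (f := fun (_ : γ) (e : Row) => e.1) snd_id.fst

theorem reducedTest : InTime B Raw.reducedTest := by
  have h1 : InTime B fun x : (Raw × List Bool) × List Bool =>
      (MaxLin.xorL x.1.2 x.2).all fun b => !b :=
    (fst_id.snd.xorL snd_id).all (f := fun _ (b : Bool) => !b) snd_id.not
  have h2 : InTime B fun x : Raw × List Bool =>
      ((x.1.2.map fun e => e.1).filter fun s =>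
        (MaxLin.xorL x.2 s).all fun b => !b).tail.isEmpty :=
    (fst_id.coeffs.filter
      (f := fun (x : Raw × List Bool) s => (MaxLin.xorL x.2 s).all fun b => !b) h1).tail.isEmpty
  exact (InTime.id.coeffs).all (f := fun (R : Raw) r => ((R.2.map fun e => e.1).filter fun s =>
        (MaxLin.xorL r s).all fun b => !b).tail.isEmpty) h2

theorem oddTest : InTime B Raw.oddTest :=
  (elim fst_id (snd_id.map (f := fun (_ : Raw) (e : Row) => e.1 ++ [true])
    (snd_id.fst.append (const _)))).fst.all (f := fun (_ : Raw) (r : List Bool) => !r.headD false)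
    (snd_id.headD rfl).not

theorem arityTest (r : ℕ) : InTime B (Raw.arityTest r) :=
  snd_id.all (f := fun (_ : Raw) (e : Row) =>
      ((e.1.filter fun b => b).drop (List.replicate r ()).length).isEmpty)
    ((snd_id.fst.filter (f := fun (_ : Raw × Row) (b : Bool) => b) snd_id).drop_length
      (const _)).isEmpty

theorem occTest (ρ : ℕ) : InTime B (Raw.occTest ρ) := by
  refine (foldl_of_measure (l := fun R : Raw => R.1)
    (i := fun R : Raw => (R.2.map fun e => e.1, true))
    (s := fun _ (x : List (List Bool) × Bool) _ => (x.1.map List.tail,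
      x.2 && ((MaxLin.pivotRows x.1).drop (List.replicate ρ ()).length).isEmpty))
    fst_id (InTime.id.coeffs.pair (const _))
    ((snd_id.fst.fst.map (f := fun _ (r : List Bool) => r.tail) snd_id.tail).pair
      (snd_id.fst.snd.and (snd_id.fst.fst.pivotRows.drop_length (const _)).isEmpty))
    (q := fun _ => 0) (b₀ := fun n => 4 * n + 4) (TimeClass.const _)
    (TimeClass.add (TimeClass.mul (TimeClass.const _) TimeClass.id) (TimeClass.const _))
    (fun x => rowMeasure x.1 + 4) (fun x => ?_) (fun R => ?_) fun _ x _ _ => ?_).snd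
  · obtain ⟨M, b⟩ := x
    have := sz_le_rowMeasure M
    have := sz_bool_le b
    rw [sz_prod]
    dsimp only
    omega
  · obtain ⟨l, M⟩ := R
    have h1 := rowMeasure_le (M.map fun e => e.1)
    have h2 : sz (M.map fun e => e.1) ≤ sz M := by
      clear h1
      induction M with
      | nil => exact le_rfl
      | cons e M ih =>
        rw [List.map_cons, sz_list_cons, sz_list_cons]
        have : sz e = sz e.1 + sz e.2 + 1 := rfl
        omega
    rw [sz_prod]
    dsimp only
    omega
  · have := rowMeasure_map_le x.1 List.tail fun r _ => by simp
    dsimp only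
    omega

theorem halve {L : γ → List Unit} (hL : InTime B L) : InTime B fun c => halve (L c) := by
  refine (foldl_of_measure (l := L) (i := fun _ => (false, ([] : List Unit)))
    (s := fun _ (x : Bool × List Unit) a => bif x.1 then (false, a :: x.2) else (true, x.2))
    hL (const _)
    (snd_id.fst.fst.cond ((const _).pair (snd_id.snd.cons snd_id.fst.snd))
      ((const _).pair snd_id.fst.snd))
    (q := fun _ => 2) (b₀ := fun _ => 5) (TimeClass.const _) (TimeClass.const _)
    (fun x => sz x.2 + 4) (fun x => ?_) (fun c => le_rfl) fun _ x a _ => ?_).snd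
  · obtain ⟨b, L⟩ := x
    have := sz_bool_le b
    rw [sz_prod]
    dsimp only
    omega
  · obtain ⟨_ | _, L⟩ := x
    · exact Nat.le_add_right _ _
    · rw [cond_true, sz_list_cons, sz_unit]
      dsimp only
      omega

theorem shrink {L : γ → List Unit} {k : γ → List Bool} (hL : InTime B L) (hk : InTime B k) :
    InTime B fun c => shrink (L c) (k c) := by
  obtain ⟨b, hb, hb'⟩ := hL.sz_le
  refine foldl_of_measure (s := fun _ (L : List Unit) _ => MaxLin.halve (MaxLin.halve L)) hk hL
    snd_id.fst.halve.halve (q := fun _ => 0) (b₀ := b) (TimeClass.const _) hb sz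
    (fun _ => le_rfl) hb' fun _ x _ _ => ?_
  rw [sz_units, sz_units, length_halve, length_halve]
  omega

theorem yesTest (D : ℕ) : InTime B fun x : Raw × ℕ => Raw.yesTest D x.1 x.2 := by
  have h1 : InTime B fun x : (Raw × ℕ) × Row =>
      !((x.2.2.2.bits.drop x.1.2.bits.length).drop (List.replicate D ()).length).isEmpty :=
    ((snd_id.snd.snd.bits.drop_length fst_id.snd.bits).drop_length (const _)).isEmpty.not
  exact (((fst_id.snd.map (f := fun (_ : Raw × ℕ) (_ : Row) => ()) (const _)).shrink
    snd_id.bits).drop_length (const _)).isEmpty.not.or (fst_id.snd.any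
      (f := fun (x : Raw × ℕ) (e : Row) =>
        !((e.2.2.bits.drop x.2.bits.length).drop (List.replicate D ()).length).isEmpty) h1)

theorem restrict : InTime B Raw.restrict := by
  have hm : InTime B Raw.mask := (elim fst_id InTime.id.coeffs).snd
  exact ((hm.filter (f := fun (_ : Raw) (b : Bool) => b) snd_id).map
    (f := fun (_ : Raw) (_ : Bool) => ()) (const _)).pair
    (snd_id.map (f := fun (R : Raw) (e : Row) => (MaxLin.sel R.mask e.1, e.2))
      (((hm.comp fst_id).sel snd_id.fst).pair snd_id.snd))

end InTime

end MaxLin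

/-! ### The kernel -/

namespace MaxLin

open Enc (enc)

/-- A yes-instance for `k = 1`: one equation `z = 0` of weight two. -/
def singleRaw : Raw := ([()], [([true], false, 2)])

/-- The kernelization on lists: trivial instances if the answer is already clear, and the
restriction to pivot columns otherwise. -/
def kernelRaw (T : Raw → Bool) (D : ℕ) (x : Raw × ℕ) : Raw × ℕ :=
  bif T x.1 && x.1.reducedTest then
    bif x.1.yesTest D x.2 then (singleRaw, 1) else (x.1.restrict, x.2)
  else (([], []), 1)

theorem InTime.kernelRaw {B : (ℕ → ℕ) → Prop} [TimeClass B] {T : Raw → Bool} (hT : InTime B T)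
    (D : ℕ) : InTime B (kernelRaw T D) :=
  ((hT.comp fst_id).and (reducedTest.comp fst_id)).cond
    ((yesTest D).cond (const _) ((restrict.comp fst_id).pair snd_id)) (const _)

/-- What the kernelization needs to know about a class of systems: it can be tested in polynomial
time and is closed under restriction to pivot columns, and reduced no-instances in it have a sum
of squared weights of at most `D * k ^ 2`. -/
structure IsSpecialCase (P : LinSystem → Prop) (Q : Raw → Prop) (T : Raw → Bool) (D : ℕ) :
    Prop where
  inTime : InTime PolyB T
  iff_raw : ∀ S : LinSystem, P S ↔ Q S.raw
  test_iff : ∀ R : Raw, R.WF → (T R = true ↔ Q R)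
  restrict : ∀ R : Raw, R.WF → Q R → Q R.restrict
  sum_sq_le : ∀ (S : LinSystem) (k : ℕ+), S.IsReduced → P S → ¬S.AboveBound k →
    ∑ j, (S.eqn j).weight ^ 2 ≤ D * (k : ℕ) ^ 2
  empty : Q ([], [])
  single : ∀ R : Raw, R.WF → Q R → R.2 ≠ [] → Q singleRaw

theorem two_pow_size_le {k : ℕ} (hk : 0 < k) : 2 ^ k.size ≤ 2 * k := by
  obtain ⟨s, hs⟩ := Nat.exists_eq_succ_of_ne_zero (Nat.size_pos.2 hk).ne'
  have h : 2 ^ s ≤ k := Nat.lt_size.1 (by omega)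
  rw [hs, pow_succ]
  omega

theorem size_le_self (k : ℕ) : k.size ≤ k := Nat.size_le.2 Nat.lt_two_pow_self

theorem LinSystem.enc_raw_pair (S : LinSystem) (k : ℕ+) :
    enc (S.raw, (k : ℕ)) = encodePair LinSystem.encode S k := by
  rw [encodePair, ← S.enc_raw]
  rfl

variable {P : LinSystem → Prop} {Q : Raw → Prop} {T : Raw → Bool} {D : ℕ}

theorem LinSystem.sum_weight_sq_raw (S : LinSystem) :
    ∑ j, (S.eqn j).weight ^ 2 = (S.raw.2.map fun e => e.2.2 ^ 2).sum := by
  simp only [LinSystem.raw, List.map_ofFn, List.sum_ofFn]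
  rfl

/-- The test for many equations or large weights accepts yes-instances only. -/
theorem IsSpecialCase.aboveBound_of_yesTest (h : IsSpecialCase P Q T D) {S : LinSystem} {k : ℕ+}
    (hS : S.IsReduced) (hP : P S) (hy : S.raw.yesTest D k = true) : S.AboveBound k := by
  by_contra hk
  have h1 := h.sum_sq_le S k hS hP hk
  rw [S.sum_weight_sq_raw] at h1
  have hk2 : (k : ℕ) < 2 ^ (k : ℕ).size := Nat.lt_size_self _
  have hk0 := k.pos
  rcases Raw.yesTest_iff.1 hy with h2 | ⟨e, he, h2⟩
  · have h3 : S.raw.2.length ≤ (S.raw.2.map fun e => e.2.2 ^ 2).sum := by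
      have := List.card_nsmul_le_sum (S.raw.2.map fun e => e.2.2 ^ 2) 1
        (List.forall_mem_map.2 fun e he => Nat.one_le_pow _ _ (S.wf_raw e he).2.2)
      simpa using this
    have h4 : (k : ℕ) ^ 2 ≤ 4 ^ (k : ℕ).size := by
      rw [show 4 = 2 ^ 2 from rfl, ← pow_mul, mul_comm, pow_mul]
      exact Nat.pow_le_pow_left hk2.le 2
    have h5 := Nat.mul_le_mul_left (D + 1) h4
    have h6 : 0 < (k : ℕ) ^ 2 := by positivity
    rw [add_mul] at h5
    omega
  · have h3 : e.2.2 ^ 2 ≤ (S.raw.2.map fun e => e.2.2 ^ 2).sum :=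
      List.single_le_sum (fun _ _ => Nat.zero_le _) _ (List.mem_map_of_mem he)
    have h4 := Nat.lt_size.1 h2
    have h5 : (k : ℕ) * (D + 1) ≤ e.2.2 := by
      refine le_trans ?_ h4
      rw [pow_add]
      exact Nat.mul_le_mul hk2.le Nat.lt_two_pow_self
    have h6 := Nat.pow_le_pow_left h5 2
    have h7 : 0 < (k : ℕ) ^ 2 := by positivity
    have h8 : ((k : ℕ) * (D + 1)) ^ 2 = D * (k : ℕ) ^ 2 + (D ^ 2 + D + 1) * (k : ℕ) ^ 2 := by ring
    have h9 : 0 < (D ^ 2 + D + 1) * (k : ℕ) ^ 2 := by positivity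
    omega

theorem IsSpecialCase.exists_kernel (h : IsSpecialCase P Q T D) (S : LinSystem) (k : ℕ+) :
    ∃ (S' : LinSystem) (k' : ℕ+), (S'.raw, (k' : ℕ)) = kernelRaw T D (S.raw, (k : ℕ)) ∧
      (S'.IsReduced ∧ P S') ∧ ((S.IsReduced ∧ P S) ∧ S.AboveBound k ↔ S'.AboveBound k') ∧
      k' ≤ k ∧ S'.m ≤ 4 * (D + 1) * (k : ℕ) ^ 2 ∧ S'.n ≤ 4 * (D + 1) * (k : ℕ) ^ 2 ∧
      ∀ e ∈ S'.raw.2, e.2.2.size ≤ k + D + 2 := by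
  have hk0 := k.pos
  have hC : 1 ≤ 4 * (D + 1) * (k : ℕ) ^ 2 := Nat.one_le_iff_ne_zero.2 (by positivity)
  have hinst : (T S.raw && S.raw.reducedTest) = true ↔ S.IsReduced ∧ P S := by
    rw [Bool.and_eq_true, h.test_iff _ S.wf_raw, ← h.iff_raw, S.wf_raw.reducedTest_iff,
      ← S.isReduced_iff, and_comm]
  by_cases hi : S.IsReduced ∧ P S
  · by_cases hy : S.raw.yesTest D k = true
    · obtain ⟨S', hS'⟩ := Raw.WF.exists_raw_eq (R := singleRaw) (by simp [Raw.WF, singleRaw])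
      have hm := S'.length_raw_snd
      have hn := S'.length_raw_fst
      have hyes : S'.AboveBound 1 := by
        rw [S'.aboveBound_iff, hS']
        exact ⟨[false], rfl, by decide⟩
      have hne : S.raw.2 ≠ [] := by
        rcases Raw.yesTest_iff.1 hy with h2 | ⟨e, he, -⟩
        · exact List.ne_nil_of_length_pos (lt_of_lt_of_le (by positivity) h2)
        · exact List.ne_nil_of_mem he
      refine ⟨S', 1, ?_, ⟨?_, ?_⟩, ?_, one_le, ?_, ?_, ?_⟩
      · simp only [kernelRaw, hinst.2 hi, hy, cond_true, hS', PNat.one_coe]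
      · rw [S'.isReduced_iff, hS']
        simp [Raw.IsReduced, singleRaw]
      · rw [h.iff_raw, hS']
        exact h.single _ S.wf_raw ((h.iff_raw S).1 hi.2) hne
      · simp only [hi, hyes, h.aboveBound_of_yesTest hi.1 hi.2 hy, and_self]
      · rw [← hm, hS']
        exact hC
      · rw [← hn, hS']
        exact hC
      · rw [hS']
        have h2 : Nat.size 2 ≤ 2 := Nat.size_le.2 (by decide)
        simp only [singleRaw, List.mem_singleton, forall_eq]
        omega
    · obtain ⟨S', hS'⟩ := S.wf_raw.restrict.exists_raw_eq
      have hm := S'.length_raw_snd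
      have hn := S'.length_raw_fst
      rw [hS', Raw.length_restrict_snd] at hm
      rw [hS'] at hn
      have hn' := S.raw.length_restrict_le
      have hy' := mt Raw.yesTest_iff.2 hy
      rw [not_or, not_le, not_exists] at hy'
      have h4 : 4 ^ (k : ℕ).size ≤ 4 * (k : ℕ) ^ 2 := by
        rw [show 4 = 2 ^ 2 from rfl, ← pow_mul, mul_comm, pow_mul, ← mul_pow]
        exact Nat.pow_le_pow_left (two_pow_size_le hk0) 2
      have h5 := Nat.mul_le_mul_left (D + 1) h4
      rw [← mul_assoc, mul_comm (D + 1) 4] at h5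
      refine ⟨S', k, ?_, ⟨?_, ?_⟩, ?_, le_rfl, ?_, ?_, ?_⟩
      · simp only [kernelRaw, hinst.2 hi, Bool.not_eq_true _ ▸ hy, cond_true, cond_false, hS']
      · rw [S'.isReduced_iff, hS']
        exact S.wf_raw.isReduced_restrict (S.isReduced_iff.1 hi.1)
      · rw [h.iff_raw, hS']
        exact h.restrict _ S.wf_raw ((h.iff_raw S).1 hi.2)
      · rw [S'.aboveBound_iff, hS', S.wf_raw.aboveBound_restrict_iff, ← S.aboveBound_iff]
        simp only [hi, and_self, true_and]
      · omega
      · omega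
      · rw [hS', Raw.forall_restrict]
        intro e he
        have h6 := hy'.2 e
        have h7 := size_le_self k
        have h8 := not_lt.1 fun h' => h6 ⟨he, h'⟩
        dsimp only
        omega
  · obtain ⟨S', hS'⟩ := Raw.WF.exists_raw_eq (R := ([], [])) (by simp [Raw.WF])
    have hm := S'.length_raw_snd
    have hn := S'.length_raw_fst
    have hno : ¬S'.AboveBound 1 := by
      rw [S'.aboveBound_iff, hS']
      rintro ⟨z, -, h1⟩
      simp [Raw.satWeight, Raw.totalWeight] at h1
    refine ⟨S', 1, ?_, ⟨?_, ?_⟩, ?_, one_le, ?_, ?_, ?_⟩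
    · simp only [kernelRaw, Bool.not_eq_true _ ▸ mt hinst.1 hi, cond_false, hS', PNat.one_coe]
    · rw [S'.isReduced_iff, hS']
      simp [Raw.IsReduced]
    · rw [h.iff_raw, hS']
      exact h.empty
    · simp only [hi, hno, false_and]
    · rw [← hm, hS']
      exact Nat.zero_le _
    · rw [← hn, hS']
      exact Nat.zero_le _
    · rw [hS']
      simp

theorem sz_nat_le (n : ℕ) : sz n ≤ 4 * n.size + 1 := by
  rw [← Nat.size_eq_bits_len]
  exact sz_bits_le n.bits

theorem LinSystem.sz_raw_le (S : LinSystem) {N b : ℕ} (hm : S.m ≤ N) (hn : S.n ≤ N)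
    (hb : ∀ e ∈ S.raw.2, e.2.2.size ≤ b) :
    sz S.raw ≤ N * (4 * N + 4 * b + 8) + 2 * N + 3 := by
  have h1 : sz S.raw = sz S.raw.1 + sz S.raw.2 + 1 := rfl
  have h2 : sz S.raw.2 ≤ S.raw.2.length * (4 * N + 4 * b + 7 + 1) + 1 := by
    refine sz_list_le fun e he => ?_
    obtain ⟨r, s, w⟩ := e
    have h3 := hb _ he
    have h4 := (S.wf_raw _ he).1
    have h5 := sz_bits_le r
    have h6 := sz_bool_le s
    have h7 := sz_nat_le w
    rw [S.length_raw_fst] at h4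
    rw [sz_prod, sz_prod]
    dsimp only at h3 h4
    omega
  rw [S.length_raw_snd] at h2
  have h3 := Nat.mul_le_mul_right (4 * N + 4 * b + 7 + 1) hm
  rw [sz_units, S.length_raw_fst] at h1
  have h4 : 4 * N + 4 * b + 7 + 1 = 4 * N + 4 * b + 8 := rfl
  rw [h4] at h2 h3
  omega

open TimeClass in
theorem IsSpecialCase.hasQuadraticKernel (h : IsSpecialCase P Q T D) : HasQuadraticKernel P := by
  choose K k' hK hinst hyes hle hm hn hsize using h.exists_kernel
  refine ⟨fun S k => (K S k, k' S k), ⟨?_, hinst, ?_, hle, ?_⟩, 4 * (D + 1), fun S k =>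
    ⟨hm S k, hn S k⟩⟩
  · obtain ⟨p, b, ⟨hb, C, c, hC⟩, hp⟩ := h.inTime.kernelRaw D
    refine ⟨p, C * 2 ^ c, c, fun S k => ?_⟩
    obtain ⟨t, e, ht⟩ := hp (S.raw, (k : ℕ))
    rw [← hK] at e
    rw [LinSystem.enc_raw_pair, LinSystem.enc_raw_pair] at e
    rw [sz, LinSystem.enc_raw_pair] at ht
    refine ⟨t, e, ht.trans ((hC _).trans ?_)⟩
    rw [mul_assoc, ← mul_pow]
    have := (encodePair LinSystem.encode S k).size_pos
    exact Nat.mul_le_mul_left _ (Nat.pow_le_pow_left (by omega) _)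
  · intro S k
    refine (hyes S k).trans ⟨fun h1 => ⟨hinst S k, h1⟩, fun h1 => h1.2⟩
  · let N : ℕ → ℕ := fun k => 4 * (D + 1) * (k * k)
    refine ⟨fun k => N k * (4 * N k + 4 * (k + (D + 2)) + 8) + 2 * N k + 3, ?_, fun S k => ?_⟩
    · have hN : PrimB N := mul (const _) (mul id id)
      have : PrimB fun k => N k * (4 * N k + 4 * (k + (D + 2)) + 8) + 2 * N k + 3 :=
        add (add (mul hN (add (add (mul (const _) hN) (mul (const _)
          (add id (const _)))) (const _))) (mul (const _) hN)) (const _)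
      exact this.2.to_comp
    · rw [← LinSystem.enc_raw]
      refine LinSystem.sz_raw_le _ ?_ ?_ (hsize S k)
      · simpa only [sq] using hm S k
      · simpa only [sq] using hn S k

/-! ### Exhaustive search -/

/-- A number in unary. -/
def unary (n : ℕ) : List Unit :=
  n.bits.reverse.foldl (fun s b => bif b then () :: (s ++ s) else s ++ s) []

theorem length_unary (n : ℕ) : (unary n).length = n := by
  rw [unary, List.foldl_reverse]
  induction n using Nat.binaryRec' with
  | zero => simp
  | bit b n hn ih =>
    rw [Nat.bits_append_bit n b hn, List.foldr_cons]
    cases b <;> simp [ih, Nat.bit] <;> omega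

/-- All bit vectors of the length of a given list. -/
def cube (l : List Unit) : List (List Bool) :=
  l.foldl (fun L _ => (L.map fun z => true :: z) ++ L.map fun z => false :: z) [[]]

theorem mem_cube {l : List Unit} {z : List Bool} : z ∈ cube l ↔ z.length = l.length := by
  have h : ∀ l : List Unit, cube l =
      l.foldr (fun _ L => (L.map fun z => true :: z) ++ L.map fun z => false :: z) [[]] :=
    fun l => by
      rw [List.foldr_eq_foldl_reverse, (List.eq_replicate_iff.2 ⟨rfl, fun _ _ => rfl⟩ :
        l = List.replicate l.length ()), List.reverse_replicate]
      rfl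
  rw [h]
  induction l generalizing z with
  | nil => simp
  | cons a l ih =>
    rw [List.foldr_cons, List.mem_append, List.mem_map, List.mem_map]
    simp only [ih]
    cases z with
    | nil => simp
    | cons b z => cases b <;> simp

/-- The total weight of the rows that satisfy a condition, in unary. -/
def unaryWeight (p : Row → Bool) (M : List Row) : List Unit :=
  M.foldl (fun s e => bif p e then unary e.2.2 ++ s else s) []

theorem length_unaryWeight (p : Row → Bool) (M : List Row) :
    (unaryWeight p M).length = (M.map fun e => if p e = true then e.2.2 else 0).sum := by
  have key : ∀ (M : List Row) (s : List Unit),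
      (M.foldl (fun s e => bif p e then unary e.2.2 ++ s else s) s).length =
        (M.map fun e => if p e = true then e.2.2 else 0).sum + s.length := by
    intro M
    induction M with
    | nil => simp
    | cons e M ih =>
      intro s
      rw [List.foldl_cons, ih]
      cases h : p e <;> simp [h, length_unary, add_assoc, add_comm, add_left_comm]
  rw [unaryWeight, key]
  simp

/-- Decide by exhaustive search whether half of the total weight can be exceeded by `k`. -/
def search (x : Raw × ℕ) : Bool :=
  (cube x.1.1).any fun z =>
    !((() :: (unaryWeight (fun e => !Bool.xor (dot e.1 z) e.2.1) x.1.2 ++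
        unaryWeight (fun e => !Bool.xor (dot e.1 z) e.2.1) x.1.2)).drop
      (unaryWeight (fun _ => true) x.1.2 ++ (unary x.2 ++ unary x.2)).length).isEmpty

theorem search_iff (R : Raw) (k : ℕ) : search (R, k) = true ↔ R.AboveBound k := by
  rw [search, List.any_eq_true]
  refine exists_congr fun z => and_congr mem_cube ?_
  rw [Bool.not_eq_true', ← Bool.not_eq_true, List.isEmpty_iff_length_eq_zero, List.length_drop,
    Nat.sub_eq_zero_iff_le, not_le, List.length_cons, List.length_append, List.length_append,
    List.length_append, length_unaryWeight, length_unaryWeight, length_unary]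
  have h : (R.2.map fun e => if (!Bool.xor (dot e.1 z) e.2.1) = true then e.2.2 else 0).sum =
      R.satWeight z := by
    unfold Raw.satWeight
    refine congrArg List.sum (List.map_congr_left fun e _ => ?_)
    cases dot e.1 z <;> cases e.2.1 <;> rfl
  rw [h]
  simp only [if_true, Raw.totalWeight]
  omega

namespace InTime

variable {γ : Type} [Enc γ]

theorem unary {f : γ → ℕ} (hf : InTime PrimB f) : InTime PrimB fun c => unary (f c) :=
  foldl_prim (s := fun _ (s : List Unit) (b : Bool) => bif b then () :: (s ++ s) else s ++ s)
    hf.bits.reverse (const _)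
    (snd_id.snd.cond ((const _).cons (snd_id.fst.append snd_id.fst)) (snd_id.fst.append snd_id.fst))

theorem cube {l : γ → List Unit} (hl : InTime PrimB l) : InTime PrimB fun c => cube (l c) :=
  foldl_prim (s := fun _ (L : List (List Bool)) (_ : Unit) =>
      (L.map fun z => true :: z) ++ L.map fun z => false :: z) hl (const _)
    ((snd_id.fst.map (f := fun _ (z : List Bool) => true :: z) ((const _).cons snd_id)).append
      (snd_id.fst.map (f := fun _ (z : List Bool) => false :: z) ((const _).cons snd_id)))

theorem dot {r z : γ → List Bool} (hr : InTime PrimB r) (hz : InTime PrimB z) :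
    InTime PrimB fun c => dot (r c) (z c) := by
  refine (foldl_prim (s := fun _ (s : Bool) (x : Bool × Bool) => Bool.xor s (x.1 && x.2))
    (i := fun _ => false) (hr.zip hz) (const _)
    (snd_id.fst.xor (snd_id.snd.fst.and snd_id.snd.snd))).of_eq fun c => ?_
  have key : ∀ (r z : List Bool) (s : Bool),
      (r.zip z).foldl (fun s x => Bool.xor s (x.1 && x.2)) s = Bool.xor s (MaxLin.dot r z) := by
    intro r
    induction r with
    | nil => simp
    | cons a r ih =>
      rintro (_ | ⟨b, z⟩) s
      · simp
      · simp [ih]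
  rw [key]
  simp

theorem unaryWeight {M : γ → List Row} {p : γ → Row → Bool} (hM : InTime PrimB M)
    (hp : InTime PrimB fun x : γ × Row => p x.1 x.2) :
    InTime PrimB fun c => unaryWeight (p c) (M c) :=
  foldl_prim (s := fun c (s : List Unit) (e : Row) =>
      bif p c e then MaxLin.unary e.2.2 ++ s else s) hM (const _)
    ((hp.comp (fst_id.pair snd_id.snd)).cond (snd_id.snd.snd.snd.unary.append snd_id.fst)
      snd_id.fst)

theorem search : InTime PrimB search := by
  have hp : InTime PrimB fun x : ((Raw × ℕ) × List Bool) × Row =>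
      !Bool.xor (MaxLin.dot x.2.1 x.1.2) x.2.2.1 :=
    ((snd_id.fst.dot fst_id.snd).xor snd_id.snd.fst).not
  have hw : InTime PrimB fun x : (Raw × ℕ) × List Bool =>
      MaxLin.unaryWeight (fun e => !Bool.xor (MaxLin.dot e.1 x.2) e.2.1) x.1.1.2 :=
    unaryWeight (p := fun (x : (Raw × ℕ) × List Bool) (e : Row) =>
      !Bool.xor (MaxLin.dot e.1 x.2) e.2.1) fst_id.fst.snd hp
  have ht : InTime PrimB fun x : (Raw × ℕ) × List Bool =>
      MaxLin.unaryWeight (fun _ => true) x.1.1.2 :=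
    unaryWeight (p := fun (_ : (Raw × ℕ) × List Bool) (_ : Row) => true) fst_id.fst.snd (const _)
  exact fst_id.fst.cube.any (f := fun (x : Raw × ℕ) (z : List Bool) =>
      !((() :: (MaxLin.unaryWeight (fun e => !Bool.xor (MaxLin.dot e.1 z) e.2.1) x.1.2 ++
          MaxLin.unaryWeight (fun e => !Bool.xor (MaxLin.dot e.1 z) e.2.1) x.1.2)).drop
        (MaxLin.unaryWeight (fun _ => true) x.1.2 ++
          (MaxLin.unary x.2 ++ MaxLin.unary x.2)).length).isEmpty)
    (((const _).cons (hw.append hw)).drop_length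
      (ht.append (fst_id.snd.unary.append fst_id.snd.unary))).isEmpty.not

end InTime

theorem PrimB.pow {f : ℕ → ℕ} (hf : PrimB f) (c : ℕ) : PrimB fun n => f n ^ c := by
  induction c with
  | zero => simpa using TimeClass.const (B := PrimB) 1
  | succ c ih => simpa only [pow_succ] using TimeClass.mul ih hf

open TimeClass in
/-- A kernelization and exhaustive search in the kernel make a fixed-parameter algorithm. -/
theorem isFPT_of_isKernelization {K : LinSystem → ℕ+ → LinSystem × ℕ+}
    (hK : IsKernelization LinSystem.encode (linALB P) K) :
    IsFPT LinSystem.encode (linALB P) := by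
  obtain ⟨⟨p, C, c, hp⟩, hinst, hyes, hle, g, hg, hsize⟩ := hK
  obtain ⟨q, b, hb, hq⟩ := InTime.search
  let a : ℕ → ℕ := fun k => 4 * k + 3
  have ha : PrimB a := add (mul (const _) id) (const _)
  refine ⟨.seq p q, fun k => C * a k ^ c + a k + b (g k + a k), c + 1, ?_, fun S k => ?_⟩
  · have h1 : PrimB fun k => C * a k ^ c + a k := add (mul (const _) (ha.pow c)) ha
    exact Primrec.nat_add.to_comp.comp h1.2.to_comp
      (hb.2.to_comp.comp (Primrec.nat_add.to_comp.comp hg ha.2.to_comp))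
  · have hsz : ∀ (S : LinSystem) (k : ℕ+), (encodePair LinSystem.encode S k).size ≤
        S.encode.size + (4 * (k : ℕ) + 2) := fun S k => by
      have h1 := sz_nat_le k
      have h2 := size_le_self k
      have h3 : (encodePair LinSystem.encode S k).size = S.encode.size + sz (k : ℕ) + 1 := rfl
      omega
    obtain ⟨t, e₁, h₁⟩ := hp S k
    obtain ⟨u, e₂, h₂⟩ := hq ((K S k).1.raw, ((K S k).2 : ℕ))
    rw [LinSystem.enc_raw_pair] at e₂
    refine ⟨_, _, .seq e₁ e₂, ?_, ?_⟩
    · have h3 : u ≤ b (g k + a k) := by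
        refine h₂.trans (hb.1 ?_)
        rw [sz, LinSystem.enc_raw_pair]
        have h4 := hsz (K S k).1 (K S k).2
        have h5 := hsize S k
        have h6 : ((K S k).2 : ℕ) ≤ k := hle S k
        simp only [a]
        omega
      have h4 := hsz S k
      have hs := S.encode.size_pos
      set s := S.encode.size
      have h5 : (encodePair LinSystem.encode S k).size ≤ a k * s := by
        have : (4 * (k : ℕ) + 2) * 1 ≤ (4 * (k : ℕ) + 2) * s := Nat.mul_le_mul_left _ hs
        simp only [a]
        rw [show 4 * (k : ℕ) + 3 = 1 + (4 * (k : ℕ) + 2) by omega, add_mul]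
        omega
      have h6 : t ≤ C * a k ^ c * s ^ (c + 1) := by
        refine h₁.trans ?_
        calc C * (encodePair LinSystem.encode S k).size ^ c ≤ C * (a k * s) ^ c :=
              Nat.mul_le_mul_left _ (Nat.pow_le_pow_left h5 _)
          _ = C * a k ^ c * s ^ c := by rw [mul_pow, mul_assoc]
          _ ≤ _ := Nat.mul_le_mul_left _ (Nat.pow_le_pow_right hs (Nat.le_succ c))
      have h7 : a k * s ≤ a k * s ^ (c + 1) :=
        Nat.mul_le_mul_left _ (Nat.le_self_pow (Nat.succ_ne_zero c) s)
      have h8 : b (g k + a k) * 1 ≤ b (g k + a k) * s ^ (c + 1) :=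
        Nat.mul_le_mul_left _ (Nat.one_le_pow _ _ hs)
      rw [add_mul, add_mul]
      omega
    · have h3 : enc (search ((K S k).1.raw, ((K S k).2 : ℕ))) ≠ Data.nil ↔
          search ((K S k).1.raw, ((K S k).2 : ℕ)) = true := by
        cases search ((K S k).1.raw, ((K S k).2 : ℕ)) <;> simp [enc, encodeBool]
      rw [h3, search_iff, ← LinSystem.aboveBound_iff, hyes S k]
      exact ⟨fun h => ⟨hinst S k, h⟩, fun h => h.2⟩

theorem IsSpecialCase.isFPT_and_hasQuadraticKernel (h : IsSpecialCase P Q T D) :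
    IsFPT LinSystem.encode (linALB P) ∧ HasQuadraticKernel P := by
  have hK := h.hasQuadraticKernel
  obtain ⟨K, hK', -⟩ := h.hasQuadraticKernel
  exact ⟨isFPT_of_isKernelization hK', hK⟩

/-! ### The three special cases -/

theorem isSpecialCase_hasOddSet :
    IsSpecialCase (fun S => S.HasOddSet) Raw.HasOddSet Raw.oddTest 4 where
  inTime := InTime.oddTest
  iff_raw S := S.hasOddSet_iff
  test_iff _ h := h.oddTest_iff
  restrict _ h := h.hasOddSet_restrict
  sum_sq_le _ _ hS hP hk := hS.sum_weight_sq_le_of_hasOddSet hP hk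
  empty := ⟨[], rfl, by simp⟩
  single _ _ _ _ := ⟨[true], rfl, by simp [singleRaw]⟩

theorem isSpecialCase_maxArity (r : ℕ) :
    IsSpecialCase (fun S => S.maxArity ≤ r) (Raw.ArityLE r) (Raw.arityTest r)
      (128 * 9 ^ r) where
  inTime := InTime.arityTest r
  iff_raw S := S.maxArity_le_iff r
  test_iff _ _ := Raw.arityTest_iff
  restrict _ _ h := h.restrict
  sum_sq_le _ _ hS hP hk := hS.sum_weight_sq_le_of_maxArity hP hk
  empty := by simp [Raw.ArityLE]
  single R hR h hne := by
    obtain ⟨e, he⟩ := List.exists_mem_of_ne_nil _ hne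
    have h1 := List.count_pos_iff.2 (hR e he).2.1
    have h2 := h e he
    simp only [Raw.ArityLE, singleRaw, List.mem_singleton, forall_eq, List.count_singleton_self]
    omega

theorem isSpecialCase_occurrences (ρ : ℕ) :
    IsSpecialCase (fun S => ∀ i, S.occurrences i ≤ ρ) (Raw.OccLE ρ) (Raw.occTest ρ)
      (128 * (2 * ρ + 1)) where
  inTime := InTime.occTest ρ
  iff_raw S := S.occurrences_le_iff ρ
  test_iff _ _ := Raw.occTest_iff
  restrict _ h := h.occLE_restrict
  sum_sq_le _ _ hS hP hk := hS.sum_weight_sq_le_of_occurrences hP hk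
  empty := by simp [Raw.OccLE]
  single R hR h hne := by
    obtain ⟨e, he⟩ := List.exists_mem_of_ne_nil _ hne
    obtain ⟨h1, h2, -⟩ := hR e he
    obtain ⟨i, hi, hi'⟩ := List.mem_iff_getElem.1 h2
    have h3 := h i (h1 ▸ hi)
    have h4 : 0 < (R.2.filter fun e => e.1.getD i false).length :=
      List.length_pos_of_mem (List.mem_filter.2 ⟨he, by simp [hi, hi']⟩)
    intro j hj
    exact (List.length_filter_le _ _).trans (h4.trans_le h3)

end MaxLin

theorem theorem2 :
    (MaxLin.IsFPT MaxLin.LinSystem.encode (MaxLin.linALB fun S => S.HasOddSet) ∧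
      MaxLin.HasQuadraticKernel fun S => S.HasOddSet) ∧
    (∀ r : ℕ,
      MaxLin.IsFPT MaxLin.LinSystem.encode (MaxLin.linALB fun S => S.maxArity ≤ r) ∧
      MaxLin.HasQuadraticKernel fun S => S.maxArity ≤ r) ∧
    (∀ ρ : ℕ,
      MaxLin.IsFPT MaxLin.LinSystem.encode
        (MaxLin.linALB fun S => ∀ i, S.occurrences i ≤ ρ) ∧
      MaxLin.HasQuadraticKernel fun S => ∀ i, S.occurrences i ≤ ρ) :=
  ⟨MaxLin.isSpecialCase_hasOddSet.isFPT_and_hasQuadraticKernel,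
    fun r => (MaxLin.isSpecialCase_maxArity r).isFPT_and_hasQuadraticKernel,
    fun ρ => (MaxLin.isSpecialCase_occurrences ρ).isFPT_and_hasQuadraticKernel⟩
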